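/- Let $G$ be a locally compact Hausdorff group with a left Haar measure $dg$, let $Y$ be a locally compact Hausdorff space with a continuous left action of $G$, and let $G\ltimes Y$ be the transformation groupoid, in which $(g,y)$ has range $y$ and source $g^{-1}y$. Let $B$ be a $G\ltimes Y$-Banach algebra, i.e. an upper semi-continuous field $(B_y)_{y\in Y}$ of complex Banach algebras over $Y$ with a continuous action of $G\ltimes Y$ by isometric isomorphisms $\alpha_{(g,y)}\colon B_{g^{-1}y}\to B_y$. Let $\Gamma_c(G\ltimes Y,r^*B)$ be the algebra of compactly supported continuous sections $\xi(g,y)\in B_y$ with the convolution product $$(\xi*\eta)(g,y)=\int_G \xi(h,y)\,\alpha_{(h,y)}\big(\eta(h^{-1}g,h^{-1}y)\big)\,dh,$$ and let $L^1(G\ltimes Y,B)$ be its completion for the norm $\|\xi\|_{L^1}=\sup_{y\in Y}\int_G\|\xi(g,y)\|\,dg$. Let $\Gamma_0(Y,B)$ be the Banach algebra of continuous sections of $B$ vanishing at infinity, with the supremum norm and the $G$-action $(g\xi)(y)=\alpha_{(g,y)}(\xi(g^{-1}y))$, and let $L^1(G,\Gamma_0(Y,B))$ be the completion of the convolution algebra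 $C_c(G,\Gamma_0(Y,B))$ for the norm $\|f\|=\int_G\|f(g)\|\,dg$. Let $\hat\iota\colon\Gamma_c(G\ltimes Y,r^*B)\to C_c(G,\Gamma_0(Y,B))$ be given by $\hat\iota(\xi)(g)=\xi(g,\cdot)$. Suppose that $Y$ is a proper $G$-space, or that $Y$ is discrete. Then there is a unique continuous algebra homomorphism $$\psi_B\colon L^1(G,\Gamma_0(Y,B))\to L^1(G\ltimes Y,B)$$ with $\psi_B(\hat\iota(\xi))=\xi$ for all $\xi\in\Gamma_c(G\ltimes Y,r^*B)$; it is norm-decreasing ($\|\psi_B(x)\|\le\|x\|$ for all $x$), and it induces isomorphisms $$\psi_{B,*}\colon K_i\big(L^1(G,\Gamma_0(Y,B))\big)\to K_i\big(L^1(G\ltimes Y,B)\big),\qquad i=0,1.$$ -/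

import Mathlib

set_option linter.unusedSectionVars false

/-! ## K-theory of complex Banach algebras -/

namespace BanachK

section K0

variable {R S : Type*} [Ring R] [Ring S]

/-- Murray-von Neumann (algebraic) equivalence `e = x y`, `f = y x` of square matrices,
possibly of different sizes. -/
def MvN {ι κ : Type} [Fintype ι] [Fintype κ] (e : Matrix ι ι R) (f : Matrix κ κ R) : Prop :=
  ∃ (x : Matrix ι κ R) (y : Matrix κ ι R), x * y = e ∧ y * x = f

section

variable {ι κ l ι' κ' : Type} [Fintype ι] [Fintype κ] [Fintype l] [Fintype ι'] [Fintype κ']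

theorem MvN.symm {e : Matrix ι ι R} {f : Matrix κ κ R} : MvN e f → MvN f e :=
  fun ⟨x, y, h, k⟩ => ⟨y, x, k, h⟩

theorem MvN.trans {e : Matrix ι ι R} {f : Matrix κ κ R} {g : Matrix l l R} (he : e * e = e)
    (hg : g * g = g) : MvN e f → MvN f g → MvN e g := by
  rintro ⟨x, y, h1, h2⟩ ⟨z, w, h3, h4⟩
  refine ⟨x * z, w * y, ?_, ?_⟩
  · calc x * z * (w * y) = x * (z * w) * y := by simp only [Matrix.mul_assoc]
      _ = (x * y) * (x * y) := by rw [h3, ← h2]; simp only [Matrix.mul_assoc]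
      _ = e := by rw [h1, he]
  · calc w * y * (x * z) = w * (y * x) * z := by simp only [Matrix.mul_assoc]
      _ = (w * z) * (w * z) := by rw [h2, ← h3]; simp only [Matrix.mul_assoc]
      _ = g := by rw [h4, hg]

/-- Idempotents that agree up to a bijection of the index sets are equivalent. -/
theorem MvN.of_equiv {e : Matrix ι ι R} {f : Matrix κ κ R} (he : e * e = e) (σ : κ ≃ ι)
    (h : f = e.submatrix σ σ) : MvN e f := by
  refine ⟨e.submatrix id σ, e.submatrix σ id, ?_, ?_⟩
  · rw [Matrix.submatrix_mul_equiv, he, Matrix.submatrix_id_id]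
  · have := Matrix.submatrix_mul_equiv e e σ (Equiv.refl _) σ
    rw [Equiv.coe_refl, he] at this
    rw [this, h]

theorem MvN.fromBlocks {e : Matrix ι ι R} {e' : Matrix ι' ι' R} {f : Matrix κ κ R}
    {f' : Matrix κ' κ' R} (h : MvN e e') (k : MvN f f') :
    MvN (Matrix.fromBlocks e 0 0 f) (Matrix.fromBlocks e' 0 0 f') := by
  obtain ⟨x, y, rfl, rfl⟩ := h
  obtain ⟨z, w, rfl, rfl⟩ := k
  refine ⟨Matrix.fromBlocks x 0 0 z, Matrix.fromBlocks y 0 0 w, ?_, ?_⟩ <;>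
  simp [Matrix.fromBlocks_multiply]

theorem idem_fromBlocks {e : Matrix ι ι R} {f : Matrix κ κ R} (he : e * e = e) (hf : f * f = f) :
    Matrix.fromBlocks e 0 0 f * Matrix.fromBlocks e 0 0 f = Matrix.fromBlocks e 0 0 f := by
  simp [Matrix.fromBlocks_multiply, he, hf]

end

/-- Block sum `a ⊕ b` of square matrices. -/
def blockSum {m n : ℕ} (a : Matrix (Fin m) (Fin m) R) (b : Matrix (Fin n) (Fin n) R) :
    Matrix (Fin (m + n)) (Fin (m + n)) R :=
  (Matrix.fromBlocks a 0 0 b).submatrix finSumFinEquiv.symm finSumFinEquiv.symm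

theorem idem_blockSum {m n : ℕ} {a : Matrix (Fin m) (Fin m) R} {b : Matrix (Fin n) (Fin n) R}
    (ha : a * a = a) (hb : b * b = b) : blockSum a b * blockSum a b = blockSum a b := by
  rw [blockSum, Matrix.submatrix_mul_equiv, idem_fromBlocks ha hb]

theorem MvN.blockSum_fromBlocks {m n : ℕ} {a : Matrix (Fin m) (Fin m) R}
    {b : Matrix (Fin n) (Fin n) R} (ha : a * a = a) (hb : b * b = b) :
    MvN (blockSum a b) (Matrix.fromBlocks a 0 0 b) :=
  (MvN.of_equiv (idem_fromBlocks ha hb) finSumFinEquiv.symm rfl).symm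

variable (R) in
/-- An idempotent square matrix of arbitrary finite size over `R`. -/
structure IdempotentMatrix where
  size : ℕ
  val : Matrix (Fin size) (Fin size) R
  idem : val * val = val

variable (R) in
instance idemSetoid : Setoid (IdempotentMatrix R) where
  r e f := MvN e.val f.val
  iseqv := ⟨fun e => ⟨e.val, e.val, e.idem, e.idem⟩, MvN.symm,
    fun {e _ g} => MvN.trans e.idem g.idem⟩

/-- The block sum `e ⊕ f`. -/
def IdempotentMatrix.sum (e f : IdempotentMatrix R) : IdempotentMatrix R :=
  ⟨e.size + f.size, blockSum e.val f.val, idem_blockSum e.idem f.idem⟩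

variable (R) in
/-- The monoid `V(R)` of equivalence classes of idempotent matrices under block sum. -/
def V : Type _ := Quotient (idemSetoid R)

instance : Zero (V R) := ⟨(⟦⟨0, 0, Subsingleton.elim _ _⟩⟧ : Quotient (idemSetoid R))⟩

instance : Add (V R) :=
  ⟨Quotient.map₂ IdempotentMatrix.sum fun e e' h f f' k =>
    ((MvN.blockSum_fromBlocks e.idem f.idem).trans (idem_blockSum e.idem f.idem)
      (idem_fromBlocks e'.idem f'.idem) (MvN.fromBlocks h k)).trans (idem_blockSum e.idem f.idem)
      (idem_blockSum e'.idem f'.idem) (MvN.blockSum_fromBlocks e'.idem f'.idem).symm⟩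

instance : AddCommMonoid (V R) where
  zero_add a := by
    induction a using Quotient.inductionOn with | _ e => ?_
    have h0 : (0 : Matrix (Fin 0) (Fin 0) R) * 0 = 0 := Subsingleton.elim _ _
    refine Quotient.sound ((MvN.blockSum_fromBlocks h0 e.idem).trans (idem_blockSum h0 e.idem)
      e.idem (MvN.of_equiv (idem_fromBlocks h0 e.idem) (Equiv.emptySum (Fin 0) _).symm ?_))
    ext i j
    simp
  add_zero a := by
    induction a using Quotient.inductionOn with | _ e => ?_
    have h0 : (0 : Matrix (Fin 0) (Fin 0) R) * 0 = 0 := Subsingleton.elim _ _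
    refine Quotient.sound ((MvN.blockSum_fromBlocks e.idem h0).trans (idem_blockSum e.idem h0)
      e.idem (MvN.of_equiv (idem_fromBlocks e.idem h0) (Equiv.sumEmpty _ (Fin 0)).symm ?_))
    ext i j
    simp
  add_comm a b := by
    induction a using Quotient.inductionOn with | _ e => ?_
    induction b using Quotient.inductionOn with | _ f => ?_
    refine Quotient.sound ((MvN.blockSum_fromBlocks e.idem f.idem).trans
      (idem_blockSum e.idem f.idem) (idem_blockSum f.idem e.idem)
      (MvN.trans (idem_fromBlocks e.idem f.idem) (idem_blockSum f.idem e.idem)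
        (f := Matrix.fromBlocks f.val 0 0 e.val)
        (MvN.of_equiv (idem_fromBlocks e.idem f.idem) (Equiv.sumComm _ _) ?_)
        (MvN.blockSum_fromBlocks f.idem e.idem).symm))
    ext (i | i) (j | j) <;> simp
  add_assoc a b c := by
    induction a using Quotient.inductionOn with | _ e => ?_
    induction b using Quotient.inductionOn with | _ f => ?_
    induction c using Quotient.inductionOn with | _ g => ?_
    have hef := idem_blockSum e.idem f.idem
    have hfg := idem_blockSum f.idem g.idem
    have h1 := (MvN.blockSum_fromBlocks hef g.idem).trans (idem_blockSum hef g.idem)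
      (idem_fromBlocks (idem_fromBlocks e.idem f.idem) g.idem)
      (MvN.fromBlocks (MvN.blockSum_fromBlocks e.idem f.idem) ⟨g.val, g.val, g.idem, g.idem⟩)
    have h2 := (MvN.blockSum_fromBlocks e.idem hfg).trans (idem_blockSum e.idem hfg)
      (idem_fromBlocks e.idem (idem_fromBlocks f.idem g.idem))
      (MvN.fromBlocks ⟨e.val, e.val, e.idem, e.idem⟩ (MvN.blockSum_fromBlocks f.idem g.idem))
    refine Quotient.sound (h1.trans (idem_blockSum hef g.idem) (idem_blockSum e.idem hfg)
      (MvN.trans (idem_fromBlocks (idem_fromBlocks e.idem f.idem) g.idem) (idem_blockSum e.idem hfg)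
        (MvN.of_equiv (idem_fromBlocks (idem_fromBlocks e.idem f.idem) g.idem)
          (Equiv.sumAssoc _ _ _).symm ?_) h2.symm))
    ext (i | i | i) (j | j | j) <;> simp
  nsmul := nsmulRec

theorem mapIdem {f : R →+* S} {n : ℕ} {e : Matrix (Fin n) (Fin n) R} (h : e * e = e) :
    e.map f * e.map f = e.map f := by
  rw [← Matrix.map_mul, h]

/-- Entrywise image of an idempotent matrix under a ring homomorphism. -/
def IdempotentMatrix.map (f : R →+* S) (e : IdempotentMatrix R) : IdempotentMatrix S :=
  ⟨e.size, e.val.map f, mapIdem e.idem⟩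

theorem MvN.map (f : R →+* S) {ι κ : Type} [Fintype ι] [Fintype κ] {e : Matrix ι ι R}
    {g : Matrix κ κ R} : MvN e g → MvN (e.map f) (g.map f) := by
  rintro ⟨x, y, rfl, rfl⟩
  exact ⟨x.map f, y.map f, by rw [← Matrix.map_mul], by rw [← Matrix.map_mul]⟩

/-- Functoriality of `V`. -/
def V.map (f : R →+* S) : V R →+ V S where
  toFun := Quotient.map (IdempotentMatrix.map f) fun _ _ h => MvN.map f h
  map_zero' := by
    refine Quotient.sound (MvN.of_equiv (mapIdem (Subsingleton.elim _ _)) (Equiv.refl (Fin 0)) ?_)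
    exact Subsingleton.elim (α := Matrix (Fin 0) (Fin 0) S) _ _
  map_add' a b := by
    induction a using Quotient.inductionOn with | _ e => ?_
    induction b using Quotient.inductionOn with | _ g => ?_
    refine Quotient.sound (MvN.of_equiv (mapIdem (idem_blockSum e.idem g.idem))
      (Equiv.refl _) ?_)
    show blockSum (e.val.map f) (g.val.map f) = (blockSum e.val g.val).map f
    rw [blockSum, blockSum, ← Matrix.submatrix_map, Matrix.fromBlocks_map]
    simp

variable (R) in
/-- `K₀` of a unital ring: the Grothendieck group of `V(R)`. -/
abbrev K0Unital : Type _ := Algebra.GrothendieckAddGroup (V R)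

/-- Functoriality of `K₀` for unital rings. -/
noncomputable def K0Unital.map (f : R →+* S) : K0Unital R →+ K0Unital S :=
  Algebra.GrothendieckAddGroup.lift (Algebra.GrothendieckAddGroup.of.comp (V.map f))

theorem K0Unital.map_of (f : R →+* S) (a : V R) :
    K0Unital.map f (Algebra.GrothendieckAddGroup.of a)
      = Algebra.GrothendieckAddGroup.of (V.map f a) :=
  DFunLike.congr_fun (Algebra.GrothendieckAddGroup.lift.symm_apply_apply
    (Algebra.GrothendieckAddGroup.of.comp (V.map f))) a

theorem K0Unital.map_comp {T : Type*} [Ring T] (g : S →+* T) (f : R →+* S) (x : K0Unital R) :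
    K0Unital.map g (K0Unital.map f x) = K0Unital.map (g.comp f) x := by
  suffices h : (K0Unital.map g).comp (K0Unital.map f) = K0Unital.map (g.comp f) from
    DFunLike.congr_fun h x
  apply Algebra.GrothendieckAddGroup.lift.symm.injective
  ext a
  show K0Unital.map g (K0Unital.map f (Algebra.GrothendieckAddGroup.of a))
    = K0Unital.map (g.comp f) (Algebra.GrothendieckAddGroup.of a)
  rw [map_of, map_of, map_of]
  congr 1
  induction a using Quotient.inductionOn with | _ e => ?_
  rfl

end K0

section K1

variable {R S : Type*} [Ring R] [Ring S]

/-- The corner embedding `a ↦ a ⊕ 1` of `n × n` into `m × m` matrices (for `n ≤ m`). -/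
def corner (n m : ℕ) (a : Matrix (Fin n) (Fin n) R) : Matrix (Fin m) (Fin m) R :=
  fun i j => if h : (i : ℕ) < n ∧ (j : ℕ) < n then a ⟨i, h.1⟩ ⟨j, h.2⟩ else if i = j then 1 else 0

theorem corner_eq {n k : ℕ} (a : Matrix (Fin n) (Fin n) R) :
    corner n (n + k) a = blockSum a 1 := by
  ext i j
  obtain ⟨i, rfl⟩ := finSumFinEquiv.surjective i
  obtain ⟨j, rfl⟩ := finSumFinEquiv.surjective j
  rcases i with i | i <;> rcases j with j | j <;> simp [corner, blockSum, Matrix.one_apply]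
  · exact if_neg fun h => by have := congrArg Fin.val h; simp at this; omega
  · exact if_neg fun h => by have := congrArg Fin.val h; simp at this; omega

/-- The corner embedding as a homomorphism of multiplicative monoids. -/
def cornerHom {n m : ℕ} (h : n ≤ m) :
    Matrix (Fin n) (Fin n) R →* Matrix (Fin m) (Fin m) R where
  toFun := corner n m
  map_one' := by
    ext i j
    by_cases hij : i = j
    · subst hij
      simp [corner]
    · have : (i : ℕ) ≠ j := fun h => hij (Fin.ext h)
      simp [corner, hij, this]
  map_mul' a b := by
    obtain ⟨k, rfl⟩ := Nat.exists_eq_add_of_le h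
    rw [corner_eq, corner_eq, corner_eq, blockSum, blockSum, blockSum,
      Matrix.submatrix_mul_equiv, Matrix.fromBlocks_multiply]
    simp

theorem corner_corner {n m k : ℕ} (h : n ≤ m) (a : Matrix (Fin n) (Fin n) R) :
    corner m k (corner n m a) = corner n k a := by
  ext i j
  by_cases h1 : (i : ℕ) < m ∧ (j : ℕ) < m
  · by_cases h2 : (i : ℕ) < n ∧ (j : ℕ) < n <;> simp [corner, h1, h2, Fin.ext_iff]
  · have h2 : ¬ ((i : ℕ) < n ∧ (j : ℕ) < n) := by omega
    simp [corner, h1, h2]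

theorem corner_self {n : ℕ} (a : Matrix (Fin n) (Fin n) R) : corner n n a = a := by
  ext i j
  simp [corner]

theorem corner_map {n m : ℕ} (f : R →+* S) (a : Matrix (Fin n) (Fin n) R) :
    corner n m (a.map f) = (corner n m a).map f := by
  ext i j
  simp only [corner, Matrix.map_apply]
  split_ifs <;> simp

variable [TopologicalSpace R]

theorem continuous_cornerHom {n m : ℕ} (h : n ≤ m) :
    Continuous (cornerHom h : Matrix (Fin n) (Fin n) R →* Matrix (Fin m) (Fin m) R) := by
  refine continuous_matrix fun i j => ?_
  show Continuous fun a => corner n m a i j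
  by_cases h : (i : ℕ) < n ∧ (j : ℕ) < n
  · simp only [corner, h, and_self, dite_true]
    fun_prop
  · simp only [corner, h, dite_false]
    fun_prop

variable [IsTopologicalRing R] [TopologicalSpace S] [IsTopologicalRing S]

variable (R) in
/-- The group `GL_n(R) / GL_n(R)₀` of path components of `GL_n(R)`. -/
abbrev GLPath (n : ℕ) : Type _ :=
  (Matrix (Fin n) (Fin n) R)ˣ ⧸ Subgroup.pathComponentOne (Matrix (Fin n) (Fin n) R)ˣ

/-- A continuous group homomorphism induces a homomorphism of groups of path components. -/
def pathMap {G H : Type*} [Group G] [TopologicalSpace G] [IsTopologicalGroup G] [Group H]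
    [TopologicalSpace H] [IsTopologicalGroup H] (f : G →* H) (hf : Continuous f) :
    G ⧸ Subgroup.pathComponentOne G →* H ⧸ Subgroup.pathComponentOne H :=
  QuotientGroup.map _ _ f fun x hx => by
    have h : Joined (1 : G) x := hx
    have := h.map hf
    rw [map_one] at this
    exact this

/-- The stabilisation maps `GL_n(R) / GL_n(R)₀ → GL_m(R) / GL_m(R)₀`. -/
def stab (n m : ℕ) (h : n ≤ m) : GLPath R n →* GLPath R m :=
  pathMap (Units.map (cornerHom h)) (Continuous.units_map _ (continuous_cornerHom h))

instance : DirectedSystem (GLPath R) (fun n m h => (stab n m h : GLPath R n → GLPath R m)) where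
  map_self n x := by
    induction x using QuotientGroup.induction_on with | _ u => ?_
    exact congrArg _ (Units.ext (corner_self u.val))
  map_map n m k h h' x := by
    induction x using QuotientGroup.induction_on with | _ u => ?_
    exact congrArg _ (Units.ext (corner_corner h u.val))

variable (R) in
/-- `K₁` of a unital Banach algebra: `GL_∞ / (GL_∞)₀`, the direct limit of the groups of path
components of `GL_n`. -/
abbrev K1Unital : Type _ := DirectLimit (GLPath R) stab

/-- Entrywise application of a continuous homomorphism on `GL_n / (GL_n)₀`. -/
def GLPath.map (f : R →+* S) (hf : Continuous f) (n : ℕ) : GLPath R n →* GLPath S n :=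
  pathMap (Units.map (f.mapMatrix (m := Fin n)).toMonoidHom)
    (Continuous.units_map _ (continuous_id.matrix_map hf))

theorem GLPath.map_stab (f : R →+* S) (hf : Continuous f) (n m : ℕ) (h : n ≤ m)
    (x : GLPath R n) : stab n m h (GLPath.map f hf n x) = GLPath.map f hf m (stab n m h x) := by
  induction x using QuotientGroup.induction_on with | _ u => ?_
  exact congrArg _ (Units.ext (corner_map f u.val))

/-- Functoriality of `K₁` for unital Banach algebras. -/
def K1Unital.map (f : R →+* S) (hf : Continuous f) : K1Unital R →* K1Unital S where
  toFun := DirectLimit.map _ _ (fun n => GLPath.map f hf n) (GLPath.map_stab f hf)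
  map_one' := by
    rw [DirectLimit.one_def 0, DirectLimit.map_def, DirectLimit.one_def 0, map_one]
  map_mul' := DirectLimit.induction₂ _ fun n x y => by
    simp only [DirectLimit.mul_def, DirectLimit.map_def, map_mul]

theorem K1Unital.map_comp {T : Type*} [Ring T] [TopologicalSpace T] [IsTopologicalRing T]
    (g : S →+* T) (hg : Continuous g) (f : R →+* S) (hf : Continuous f) (x : K1Unital R) :
    K1Unital.map g hg (K1Unital.map f hf x) = K1Unital.map (g.comp f) (hg.comp hf) x := by
  induction x using DirectLimit.induction with | _ n x => ?_
  induction x using QuotientGroup.induction_on with | _ u => ?_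
  have h : GLPath.map g hg n (GLPath.map f hf n u) = GLPath.map (g.comp f) (hg.comp hf) n u :=
    congrArg _ (Units.ext rfl)
  exact congrArg (fun y : GLPath T n => (⟦⟨n, y⟩⟧ : K1Unital T)) h

end K1

section NonUnital

variable (A : Type*) [NonUnitalNormedRing A] [NormedSpace ℂ A] [IsScalarTower ℂ A A]
  [SMulCommClass ℂ A A]

/-- The unitisation `A⁺ = ℂ ⊕ A` of a complex Banach algebra, with the norm `|z| + ‖a‖`. -/
abbrev Plus : Type _ := WithLp 1 (Unitization ℂ A)

/-- The canonical character `A⁺ → ℂ` with kernel `A`. -/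
noncomputable def scalarPart : Plus A →+* ℂ :=
  ((Unitization.fstHom ℂ A).comp
    (WithLp.unitizationAlgEquiv (𝕜 := ℂ) (A := A) ℂ).toAlgHom).toRingHom

theorem continuous_scalarPart : Continuous (scalarPart A) :=
  AddMonoidHomClass.continuous_of_bound (scalarPart A) 1 fun x => by
    rw [WithLp.unitization_norm_def, one_mul]
    exact le_add_of_nonneg_right (norm_nonneg _)

variable {A} {B : Type*} [NonUnitalNormedRing B] [NormedSpace ℂ B] [IsScalarTower ℂ B B]
  [SMulCommClass ℂ B B]

/-- The unital extension `φ⁺ : A⁺ → B⁺`, `z + a ↦ z + φ a`. -/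
noncomputable def plusMap (φ : A →ₙₐ[ℂ] B) : Plus A →+* Plus B :=
  ((WithLp.unitizationAlgEquiv (𝕜 := ℂ) (A := B) ℂ).symm.toAlgHom.comp
    ((Unitization.lift ((Unitization.inrNonUnitalAlgHom ℂ B).comp φ)).comp
      (WithLp.unitizationAlgEquiv (𝕜 := ℂ) (A := A) ℂ).toAlgHom)).toRingHom

theorem plusMap_apply (φ : A →ₙₐ[ℂ] B) (x : Plus A) :
    plusMap φ x = algebraMap ℂ (Plus B) (scalarPart A x) +
      WithLp.toLp 1 (φ (WithLp.ofLp x).snd : Unitization ℂ B) := rfl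

theorem continuous_plusMap (φ : A →ₙₐ[ℂ] B) (hφ : Continuous φ) : Continuous (plusMap φ) := by
  have h : Continuous fun x : Plus A => (WithLp.ofLp x).snd :=
    AddMonoidHomClass.continuous_of_bound (AddMonoidHom.mk' (fun x : Plus A => (WithLp.ofLp x).snd)
      fun _ _ => rfl) 1 fun x => by
      rw [WithLp.unitization_norm_def, one_mul]
      exact le_add_of_nonneg_left (norm_nonneg _)
  exact ((continuous_algebraMap ℂ (Plus B)).comp (continuous_scalarPart A)).add
    (WithLp.unitization_isometry_inr.continuous.comp (hφ.comp h))

theorem scalarPart_comp_plusMap (φ : A →ₙₐ[ℂ] B) :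
    (scalarPart B).comp (plusMap φ) = scalarPart A := by
  ext x
  show scalarPart A x + 0 = _
  rw [add_zero]

variable (A) in
/-- `K₀(A) = ker (K₀(A⁺) → K₀(ℂ))`. -/
noncomputable def K0 : AddSubgroup (K0Unital (Plus A)) := (K0Unital.map (scalarPart A)).ker

variable (A) in
/-- `K₁(A) = ker (K₁(A⁺) → K₁(ℂ))`. -/
noncomputable def K1 : Subgroup (K1Unital (Plus A)) :=
  (K1Unital.map (scalarPart A) (continuous_scalarPart A)).ker

/-- The map `φ_* : K₀(A) → K₀(B)`. -/
noncomputable def K0.map (φ : A →ₙₐ[ℂ] B) : K0 A →+ K0 B :=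
  ((K0Unital.map (plusMap φ)).comp (K0 A).subtype).codRestrict (K0 B) fun x => by
    have hx : K0Unital.map (scalarPart A) x = 0 := x.2
    show K0Unital.map (scalarPart B) (K0Unital.map (plusMap φ) x) = 0
    rw [K0Unital.map_comp, scalarPart_comp_plusMap, hx]

/-- The map `φ_* : K₁(A) → K₁(B)`. -/
noncomputable def K1.map (φ : A →ₙₐ[ℂ] B) (hφ : Continuous φ) : K1 A →* K1 B :=
  ((K1Unital.map (plusMap φ) (continuous_plusMap φ hφ)).comp (K1 A).subtype).codRestrict (K1 B)
    fun x => by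
      have hx : K1Unital.map (scalarPart A) (continuous_scalarPart A) x = 1 := x.2
      show K1Unital.map (scalarPart B) (continuous_scalarPart B) (K1Unital.map (plusMap φ)
        (continuous_plusMap φ hφ) x) = 1
      rw [K1Unital.map_comp]
      simp only [scalarPart_comp_plusMap]
      exact hx

end NonUnital

end BanachK

/-! ## Fields of Banach algebras and `L¹`-algebras of transformation groupoids -/

open MeasureTheory Filter Topology Set
open scoped ENNReal

namespace BanachField

section Field

variable {Y : Type*} [TopologicalSpace Y] {B : Y → Type*} [∀ y, NonUnitalNormedRing (B y)]
  [∀ y, NormedSpace ℂ (B y)]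

variable (B) in
/-- An upper semi-continuous field of (complex) Banach algebras over `Y` with fibres `B y`: a linear
space of sections, closed under pointwise products, with dense values in every fibre and upper
semi-continuous norm functions, and which contains every section that can be locally uniformly
approximated by its members. -/
structure USCField where
  sections : Submodule ℂ (∀ y, B y)
  dense_values : ∀ y, Dense {b : B y | ∃ ξ ∈ sections, ξ y = b}
  upperSemicontinuous_norm : ∀ ξ ∈ sections, UpperSemicontinuous fun y => ‖ξ y‖
  mem_of_locally_approx : ∀ ξ : ∀ y, B y,
    (∀ y, ∀ ε > 0, ∃ η ∈ sections, ∀ᶠ z in 𝓝 y, ‖ξ z - η z‖ ≤ ε) → ξ ∈ sections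
  mul_mem : ∀ ξ ∈ sections, ∀ η ∈ sections, ξ * η ∈ sections

namespace USCField

variable (F : USCField B) {Z W : Type*} [TopologicalSpace Z] [TopologicalSpace W]

/-- The (continuous) sections of the pullback field `p^* B` along `p : Z → Y`: those families
`ζ z ∈ B (p z)` which are locally uniform limits of sections `η ∘ p` with `η` a section of `B`. -/
def IsSection (p : Z → Y) (ζ : ∀ z, B (p z)) : Prop :=
  ∀ z, ∀ ε > 0, ∃ η ∈ F.sections, ∀ᶠ w in 𝓝 z, ‖ζ w - η (p w)‖ ≤ ε

variable {F}

theorem isSection_of_mem {η : ∀ y, B y} (hη : η ∈ F.sections) (p : Z → Y) :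
    F.IsSection p fun z => η (p z) :=
  fun z ε hε => ⟨η, hη, Eventually.of_forall fun w => by simpa using hε.le⟩

theorem isSection_zero (p : Z → Y) : F.IsSection p fun _ => 0 :=
  isSection_of_mem F.sections.zero_mem p

theorem mem_of_isSection {η : ∀ y, B y} (h : F.IsSection (fun y : Y => y) η) : η ∈ F.sections :=
  F.mem_of_locally_approx η h

theorem IsSection.comp {p : Z → Y} {ζ : ∀ z, B (p z)} (h : F.IsSection p ζ) {q : W → Z}
    (hq : Continuous q) : F.IsSection (fun w => p (q w)) fun w => ζ (q w) := fun w ε hε =>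
  let ⟨η, hη, h1⟩ := h (q w) ε hε
  ⟨η, hη, hq.continuousAt.eventually h1⟩

theorem IsSection.of_approx {p : Z → Y} {ζ : ∀ z, B (p z)}
    (h : ∀ z, ∀ ε > 0, ∃ ζ', F.IsSection p ζ' ∧ ∀ᶠ w in 𝓝 z, ‖ζ w - ζ' w‖ ≤ ε) :
    F.IsSection p ζ := fun z ε hε => by
  obtain ⟨ζ', h1, h2⟩ := h z (ε / 2) (half_pos hε)
  obtain ⟨η, hη, h3⟩ := h1 z (ε / 2) (half_pos hε)
  refine ⟨η, hη, ?_⟩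
  filter_upwards [h2, h3] with w h4 h5
  calc ‖ζ w - η (p w)‖ = ‖(ζ w - ζ' w) + (ζ' w - η (p w))‖ := by rw [sub_add_sub_cancel]
    _ ≤ ε := (norm_add_le _ _).trans (by linarith)

theorem IsSection.add {p : Z → Y} {ζ ζ' : ∀ z, B (p z)} (h : F.IsSection p ζ)
    (h' : F.IsSection p ζ') : F.IsSection p fun z => ζ z + ζ' z := fun z ε hε => by
  obtain ⟨η, hη, h1⟩ := h z (ε / 2) (half_pos hε)
  obtain ⟨η', hη', h2⟩ := h' z (ε / 2) (half_pos hε)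
  refine ⟨η + η', F.sections.add_mem hη hη', ?_⟩
  filter_upwards [h1, h2] with w h4 h5
  calc ‖ζ w + ζ' w - (η + η') (p w)‖ = ‖(ζ w - η (p w)) + (ζ' w - η' (p w))‖ := by
        rw [Pi.add_apply, add_sub_add_comm]
    _ ≤ ε := (norm_add_le _ _).trans (by linarith)

theorem IsSection.smul {p : Z → Y} {ζ : ∀ z, B (p z)} (h : F.IsSection p ζ) (c : ℂ) :
    F.IsSection p fun z => c • ζ z := fun z ε hε => by
  obtain ⟨η, hη, h1⟩ := h z (ε / (‖c‖ + 1)) (by positivity)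
  refine ⟨c • η, F.sections.smul_mem c hη, ?_⟩
  filter_upwards [h1] with w h4
  rw [Pi.smul_apply, ← smul_sub, norm_smul]
  calc ‖c‖ * ‖ζ w - η (p w)‖ ≤ (‖c‖ + 1) * (ε / (‖c‖ + 1)) := by gcongr; linarith
    _ = ε := by field_simp

theorem IsSection.sub {p : Z → Y} {ζ ζ' : ∀ z, B (p z)} (h : F.IsSection p ζ)
    (h' : F.IsSection p ζ') : F.IsSection p fun z => ζ z - ζ' z := by
  simpa [sub_eq_add_neg] using h.add (h'.smul (-1))

theorem IsSection.norm_lt {p : Z → Y} (hp : Continuous p) {ζ : ∀ z, B (p z)}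
    (h : F.IsSection p ζ) {z : Z} {c : ℝ} (hc : ‖ζ z‖ < c) : ∀ᶠ w in 𝓝 z, ‖ζ w‖ < c := by
  have hε : 0 < (c - ‖ζ z‖) / 3 := by linarith
  obtain ⟨η, hη, h1⟩ := h z _ hε
  have h2 : ‖η (p z)‖ < ‖ζ z‖ + 2 * ((c - ‖ζ z‖) / 3) := by
    have h3 : ‖η (p z)‖ ≤ ‖ζ z‖ + ‖ζ z - η (p z)‖ := by
      simpa using norm_sub_le (ζ z) (ζ z - η (p z))
    have := h1.self_of_nhds
    linarith
  filter_upwards [h1, hp.continuousAt.eventually (F.upperSemicontinuous_norm η hη (p z) _ h2)]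
    with w h4 h5
  have h6 : ‖ζ w‖ ≤ ‖ζ w - η (p w)‖ + ‖η (p w)‖ := by
    simpa using norm_add_le (ζ w - η (p w)) (η (p w))
  linarith

theorem IsSection.mul {p : Z → Y} (hp : Continuous p) {ζ ζ' : ∀ z, B (p z)}
    (h : F.IsSection p ζ) (h' : F.IsSection p ζ') : F.IsSection p fun z => ζ z * ζ' z :=
  fun z ε hε => by
  obtain ⟨η', hη', h2⟩ := h' z (ε / (2 * (‖ζ z‖ + 1))) (by positivity)
  have h3 : ∀ᶠ w in 𝓝 z, ‖η' (p w)‖ < ‖η' (p z)‖ + 1 :=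
    (isSection_of_mem hη' p).norm_lt hp (by simp)
  obtain ⟨η, hη, h1⟩ := h z (ε / (2 * (‖η' (p z)‖ + 1))) (by positivity)
  refine ⟨η * η', F.mul_mem η hη η' hη', ?_⟩
  filter_upwards [h1, h2, h3, h.norm_lt hp (lt_add_one ‖ζ z‖)] with w h4 h5 h6 h7
  calc ‖ζ w * ζ' w - (η * η') (p w)‖
      = ‖ζ w * (ζ' w - η' (p w)) + (ζ w - η (p w)) * η' (p w)‖ := by
        rw [Pi.mul_apply, mul_sub, sub_mul, sub_add_sub_cancel]
    _ ≤ ‖ζ w‖ * ‖ζ' w - η' (p w)‖ + ‖ζ w - η (p w)‖ * ‖η' (p w)‖ :=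
        (norm_add_le _ _).trans (add_le_add (norm_mul_le _ _) (norm_mul_le _ _))
    _ ≤ (‖ζ z‖ + 1) * (ε / (2 * (‖ζ z‖ + 1)))
          + (ε / (2 * (‖η' (p z)‖ + 1))) * (‖η' (p z)‖ + 1) := by gcongr
    _ = ε := by field_simp; ring

/-- A section over a map with constant value `y` is a continuous function into the fibre. -/
theorem IsSection.continuous {y : Y} {f : Z → B y} (h : F.IsSection (fun _ => y) f) :
    Continuous f := continuous_iff_continuousAt.2 fun z => Metric.tendsto_nhds.2 fun ε hε => by
  obtain ⟨η, hη, h1⟩ := h z (ε / 3) (by positivity)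
  filter_upwards [h1] with w hw
  have h2 := h1.self_of_nhds
  rw [dist_eq_norm]
  calc ‖f w - f z‖ = ‖(f w - η y) - (f z - η y)‖ := by rw [sub_sub_sub_cancel_right]
    _ ≤ ‖f w - η y‖ + ‖f z - η y‖ := norm_sub_le _ _
    _ < ε := by linarith

theorem IsSection.exists_bound {p : Z → Y} (hp : Continuous p) {ζ : ∀ z, B (p z)}
    (h : F.IsSection p ζ) {K : Set Z} (hK : IsCompact K) : ∃ C : ℝ, 0 ≤ C ∧ ∀ z ∈ K, ‖ζ z‖ ≤ C := by
  refine hK.induction_on (p := fun s => ∃ C : ℝ, 0 ≤ C ∧ ∀ z ∈ s, ‖ζ z‖ ≤ C) ⟨0, le_rfl, by simp⟩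
    (fun s t hst ⟨C, h0, h1⟩ => ⟨C, h0, fun z hz => h1 z (hst hz)⟩)
    (fun s t ⟨C, h0, h1⟩ ⟨D, h2, h3⟩ => ⟨max C D, le_max_of_le_left h0, ?_⟩) fun z _ => ?_
  · rintro z (hz | hz)
    · exact (h1 z hz).trans (le_max_left _ _)
    · exact (h3 z hz).trans (le_max_right _ _)
  · refine ⟨_, mem_nhdsWithin_of_mem_nhds (h.norm_lt hp (lt_add_one ‖ζ z‖)), ‖ζ z‖ + 1,
      by positivity, fun w hw => le_of_lt hw⟩

/-- Integrating a section with compact support in the integration variable. -/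
theorem IsSection.integral [∀ y, CompleteSpace (B y)] {G : Type*} [TopologicalSpace G] [T2Space G]
    [MeasurableSpace G] [BorelSpace G] (μ : Measure G) [IsFiniteMeasureOnCompacts μ] {p : Z → Y}
    {ζ : ∀ q : G × Z, B (p q.2)} (h : F.IsSection (fun q : G × Z => p q.2) ζ)
    {K : Set G} (hK : IsCompact K) (hζ : ∀ g z, g ∉ K → ζ (g, z) = 0) :
    F.IsSection p fun z => ∫ g, ζ (g, z) ∂μ := fun z ε hε => by
  have hcont (w : Z) : Continuous (fun g => ζ (g, w) : G → B (p w)) :=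
    IsSection.continuous (y := p w) (h.comp (q := fun g => (g, w)) (by fun_prop))
  let f (w : Z) : G → B (p w) := fun g => ζ (g, w)
  have hint (w : Z) : Integrable (f w) μ :=
    Continuous.integrable_of_hasCompactSupport (hcont w)
      (HasCompactSupport.intro hK fun g hg => hζ g w hg)
  set δ := ε / (μ.real K + 1) with hδ
  have hδ0 : 0 < δ := div_pos hε (add_pos_of_nonneg_of_pos measureReal_nonneg one_pos)
  have key : ∃ s, K ⊆ s ∧ MeasurableSet s ∧ ∀ T ⊆ s, T ⊆ K → MeasurableSet T →
      ∃ η ∈ F.sections, ∀ᶠ w in 𝓝 z, ‖(∫ g in T, ζ (g, w) ∂μ) - η (p w)‖ ≤ δ * μ.real T := by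
    refine hK.induction_on (p := fun k => ∃ s, k ⊆ s ∧ MeasurableSet s ∧ ∀ T ⊆ s, T ⊆ K →
      MeasurableSet T → ∃ η ∈ F.sections, ∀ᶠ w in 𝓝 z,
        ‖(∫ g in T, ζ (g, w) ∂μ) - η (p w)‖ ≤ δ * μ.real T) ?_ ?_ ?_ ?_
    · refine ⟨∅, le_rfl, MeasurableSet.empty, fun T hT _ _ => ⟨0, F.sections.zero_mem, ?_⟩⟩
      obtain rfl := subset_empty_iff.1 hT
      simp
    · rintro k k' hkk ⟨s, h1, h2⟩
      exact ⟨s, hkk.trans h1, h2⟩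
    · rintro k k' ⟨s, h1, h2, h3⟩ ⟨s', h1', h2', h3'⟩
      refine ⟨s ∪ s', union_subset_union h1 h1', h2.union h2', fun T hT hTK hTm => ?_⟩
      obtain ⟨η, hη, h4⟩ := h3 (T ∩ s) inter_subset_right (inter_subset_left.trans hTK)
        (hTm.inter h2)
      obtain ⟨η', hη', h5⟩ := h3' (T \ s) (fun x hx => (hT hx.1).resolve_left hx.2)
        (sdiff_subset.trans hTK) (hTm.diff h2)
      refine ⟨η + η', F.sections.add_mem hη hη', ?_⟩
      filter_upwards [h4, h5] with w h6 h7
      have hfin : μ T ≠ ∞ := (measure_mono hTK).trans_lt hK.measure_lt_top |>.ne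
      rw [← integral_inter_add_sdiff h2 (hint w).integrableOn,
        ← measureReal_inter_add_sdiff (μ := μ) h2 (h := hfin), mul_add, Pi.add_apply,
        add_sub_add_comm]
      exact (norm_add_le _ _).trans (add_le_add h6 h7)
    · intro g _
      obtain ⟨η, hη, h1⟩ := h (g, z) δ hδ0
      rw [nhds_prod_eq, eventually_prod_iff] at h1
      obtain ⟨P, hP, Q, hQ, hPQ⟩ := h1
      obtain ⟨U, hU, hUo, hgU⟩ := eventually_nhds_iff.1 hP
      refine ⟨U, mem_nhdsWithin_of_mem_nhds (hUo.mem_nhds hgU), U, le_rfl, hUo.measurableSet,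
        fun T hT hTK hTm => ?_⟩
      have hfin : μ T < ∞ := (measure_mono hTK).trans_lt hK.measure_lt_top
      refine ⟨((μ.real T : ℝ) : ℂ) • η, F.sections.smul_mem _ hη, ?_⟩
      filter_upwards [hQ] with w hw
      have h2 : (((μ.real T : ℝ) : ℂ) • η) (p w) = ∫ _ in T, η (p w) ∂μ := by
        rw [setIntegral_const, Pi.smul_apply, Complex.coe_smul]
      rw [h2, ← integral_sub (hint w).integrableOn (integrableOn_const hfin.ne)]
      exact norm_setIntegral_le_of_norm_le_const hfin fun x hx => hPQ (hU x (hT hx)) hw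
  obtain ⟨s, h1, _, h3⟩ := key
  obtain ⟨η, hη, h4⟩ := h3 K h1 le_rfl hK.isClosed.measurableSet
  refine ⟨η, hη, ?_⟩
  filter_upwards [h4] with w hw
  rw [setIntegral_eq_integral_of_forall_compl_eq_zero fun g hg => hζ g w hg] at hw
  refine hw.trans ?_
  rw [hδ, div_mul_eq_mul_div, div_le_iff₀ (add_pos_of_nonneg_of_pos measureReal_nonneg one_pos)]
  gcongr
  linarith

end USCField

end Field

section Equivariant

variable {G Y : Type*} [Group G] [TopologicalSpace G] [TopologicalSpace Y] [MulAction G Y]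
  {B : Y → Type*} [∀ y, NonUnitalNormedRing (B y)] [∀ y, NormedSpace ℂ (B y)]

variable (G B) in
/-- A `G ⋉ Y`-Banach algebra: a u.s.c. field of Banach algebras over `Y` with a continuous isometric
action of the transformation groupoid `G ⋉ Y`. The arrow `(g, y)` of `G ⋉ Y` has range `y` and
source `g⁻¹ • y`; `act g (h : g • x = y) : B x → B y` is the action of the arrow `(g, y)` with
source `x`. Continuity says that `act` maps sections of `s^* B` to sections of `r^* B`. -/
structure EquivariantField extends USCField B where
  act : ∀ (g : G) {x y : Y}, g • x = y → (B x →ₙₐ[ℂ] B y)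
  norm_act : ∀ (g : G) {x y : Y} (h : g • x = y) (b : B x), ‖act g h b‖ = ‖b‖
  act_one : ∀ (y : Y) (b : B y), act 1 (one_smul G y) b = b
  act_mul : ∀ (g h : G) {x y z : Y} (hxy : h • x = y) (hyz : g • y = z) (hxz : (g * h) • x = z)
    (b : B x), act (g * h) hxz b = act g hyz (act h hxy b)
  isSection_act : ∀ ζ : (∀ q : G × Y, B (q.1⁻¹ • q.2)),
    toUSCField.IsSection (fun q : G × Y => q.1⁻¹ • q.2) ζ →
    toUSCField.IsSection (fun q : G × Y => q.2) fun q => act q.1 (smul_inv_smul q.1 q.2) (ζ q)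

variable (E : EquivariantField G B)

namespace EquivariantField

theorem act_congr (θ : ∀ y, B y) (g : G) {x x' y : Y} (h : g • x = y) (h' : g • x' = y) :
    E.act g h (θ x) = E.act g h' (θ x') := by
  obtain rfl : x = x' := by
    rw [← inv_smul_smul g x, ← inv_smul_smul g x', h, h']
  rfl

/-- The action of an arrow as a continuous linear map. -/
def actL (g : G) {x y : Y} (h : g • x = y) : B x →L[ℂ] B y :=
  LinearMap.mkContinuous
    { toFun := E.act g h, map_add' := map_add (E.act g h), map_smul' := map_smul (E.act g h) } 1
    fun b => by rw [one_mul]; exact (E.norm_act g h b).le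

theorem isSection_act' [IsTopologicalGroup G] [ContinuousSMul G Y] {W : Type*} [TopologicalSpace W]
    {g : W → G} (hg : Continuous g) {r : W → Y} (hr : Continuous r) {ζ : ∀ w, B ((g w)⁻¹ • r w)}
    (h : E.IsSection (fun w => (g w)⁻¹ • r w) ζ) :
    E.IsSection r fun w => E.act (g w) (smul_inv_smul (g w) (r w)) (ζ w) := by
  refine USCField.IsSection.of_approx fun w ε hε => ?_
  obtain ⟨η, hη, h1⟩ := h w ε hε
  refine ⟨_, (E.isSection_act (fun q => η (q.1⁻¹ • q.2))
    (USCField.isSection_of_mem hη _)).comp (q := fun w => (g w, r w)) (hg.prodMk hr), ?_⟩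
  filter_upwards [h1] with v hv
  rwa [← map_sub, E.norm_act]

/-- The space `Γ_c(G ⋉ Y, r^* B)` of continuous sections with compact support of the pullback of `B`
along the range map `r (g, y) = y`. -/
def sectionsCompact : Submodule ℂ (G → ∀ y, B y) where
  carrier := {ξ | E.IsSection (fun q : G × Y => q.2) (fun q => ξ q.1 q.2) ∧
    ∃ K : Set (G × Y), IsCompact K ∧ ∀ g y, (g, y) ∉ K → ξ g y = 0}
  zero_mem' := ⟨USCField.isSection_zero _, ∅, isCompact_empty, fun _ _ _ => rfl⟩
  add_mem' := by
    rintro ξ η ⟨h, K, hK, h1⟩ ⟨h', K', hK', h1'⟩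
    refine ⟨h.add h', K ∪ K', hK.union hK', fun g y hy => ?_⟩
    simp [h1 g y fun h => hy (Or.inl h), h1' g y fun h => hy (Or.inr h)]
  smul_mem' := by
    rintro c ξ ⟨h, K, hK, h1⟩
    refine ⟨h.smul c, K, hK, fun g y hy => ?_⟩
    simp [h1 g y hy]

variable {E}

theorem continuous_left {ξ : G → ∀ y, B y} (hξ : ξ ∈ E.sectionsCompact) (y : Y) :
    Continuous fun g => ξ g y :=
  USCField.IsSection.continuous (F := E.toUSCField) (y := y)
    (hξ.1.comp (q := fun g => (g, y)) (by fun_prop))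

theorem exists_compact_left {ξ : G → ∀ y, B y} (hξ : ξ ∈ E.sectionsCompact) :
    ∃ K : Set G, IsCompact K ∧ ∀ g y, g ∉ K → ξ g y = 0 := by
  obtain ⟨_, K, hK, h⟩ := hξ
  exact ⟨Prod.fst '' K, hK.image continuous_fst, fun g y hg => h g y fun h' =>
    hg ⟨_, h', rfl⟩⟩

theorem hasCompactSupport_left [T2Space G] {ξ : G → ∀ y, B y} (hξ : ξ ∈ E.sectionsCompact) (y : Y) :
    HasCompactSupport fun g => ξ g y := by
  obtain ⟨K, hK, h⟩ := exists_compact_left hξ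
  exact HasCompactSupport.intro hK fun g hg => h g y hg

variable (E) [MeasurableSpace G] (μ : Measure G)

/-- Convolution, `(ξ * η)(g, y) = ∫ ξ(h, y) α_{(h, y)} (η(h⁻¹ g, h⁻¹ y)) dh`. -/
noncomputable def conv (ξ η : G → ∀ y, B y) : G → ∀ y, B y := fun g y =>
  ∫ h, ξ h y * E.act h (smul_inv_smul h y) (η (h⁻¹ * g) (h⁻¹ • y)) ∂μ

/-- The norm of `L¹(G ⋉ Y, B)`: `‖ξ‖ = sup_y ∫ ‖ξ(g, y)‖ dg`. -/
noncomputable def l1norm (μ : Measure G) (ξ : G → ∀ y, B y) : ℝ := ⨆ y, ∫ g, ‖ξ g y‖ ∂μ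

theorem l1norm_nonneg (ξ : G → ∀ y, B y) : 0 ≤ l1norm μ ξ :=
  Real.iSup_nonneg fun _ => integral_nonneg fun _ => norm_nonneg _

variable {E}

section

variable [T2Space G] [BorelSpace G] [IsFiniteMeasureOnCompacts μ]

theorem integrable_left {ξ : G → ∀ y, B y} (hξ : ξ ∈ E.sectionsCompact) (y : Y) :
    Integrable (fun g => ξ g y) μ :=
  (continuous_left hξ y).integrable_of_hasCompactSupport (hasCompactSupport_left hξ y)

theorem bddAbove_l1norm {ξ : G → ∀ y, B y} (hξ : ξ ∈ E.sectionsCompact) :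
    BddAbove (range fun y => ∫ g, ‖ξ g y‖ ∂μ) := by
  obtain ⟨h, K, hK, h1⟩ := id hξ
  obtain ⟨C, h0, hC⟩ := h.exists_bound continuous_snd hK
  have hC' (g : G) (y : Y) : ‖ξ g y‖ ≤ C := by
    by_cases hg : (g, y) ∈ K
    · exact hC _ hg
    · simpa [h1 g y hg] using h0
  obtain ⟨L, hL, h2⟩ := exists_compact_left hξ
  refine ⟨C * μ.real L, ?_⟩
  rintro _ ⟨y, rfl⟩
  show ∫ g, ‖ξ g y‖ ∂μ ≤ _
  have h3 : ∫ g, ‖ξ g y‖ ∂μ = ∫ g in L, ‖ξ g y‖ ∂μ :=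
    (setIntegral_eq_integral_of_forall_compl_eq_zero fun g hg => by simp [h2 g y hg]).symm
  rw [h3]
  refine (le_abs_self _).trans ?_
  rw [← Real.norm_eq_abs]
  exact norm_setIntegral_le_of_norm_le_const hL.measure_lt_top fun g _ => by simpa using hC' g y

theorem integral_le_l1norm {ξ : G → ∀ y, B y} (hξ : ξ ∈ E.sectionsCompact) (y : Y) :
    ∫ g, ‖ξ g y‖ ∂μ ≤ l1norm μ ξ :=
  le_ciSup (bddAbove_l1norm μ hξ) y

theorem l1norm_add_le {ξ η : G → ∀ y, B y} (hξ : ξ ∈ E.sectionsCompact)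
    (hη : η ∈ E.sectionsCompact) : l1norm μ (ξ + η) ≤ l1norm μ ξ + l1norm μ η := by
  refine Real.iSup_le (fun y => ?_) (add_nonneg (l1norm_nonneg μ ξ) (l1norm_nonneg μ η))
  calc ∫ g, ‖(ξ + η) g y‖ ∂μ ≤ ∫ g, (‖ξ g y‖ + ‖η g y‖) ∂μ :=
        integral_mono (integrable_left μ (E.sectionsCompact.add_mem hξ hη) y).norm
          ((integrable_left μ hξ y).norm.add (integrable_left μ hη y).norm)
          fun g => norm_add_le _ _
    _ = ∫ g, ‖ξ g y‖ ∂μ + ∫ g, ‖η g y‖ ∂μ :=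
        integral_add (integrable_left μ hξ y).norm (integrable_left μ hη y).norm
    _ ≤ _ := add_le_add (integral_le_l1norm μ hξ y) (integral_le_l1norm μ hη y)

theorem l1norm_smul (c : ℂ) (ξ : G → ∀ y, B y) : l1norm μ (c • ξ) = ‖c‖ * l1norm μ ξ := by
  simp only [l1norm, Pi.smul_apply, norm_smul, integral_const_mul]
  rw [Real.mul_iSup_of_nonneg (norm_nonneg c)]

theorem eq_zero_of_l1norm [μ.IsOpenPosMeasure] {ξ : G → ∀ y, B y} (hξ : ξ ∈ E.sectionsCompact)
    (h : l1norm μ ξ = 0) : ξ = 0 := by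
  funext g y
  have h1 : ∫ g, ‖ξ g y‖ ∂μ = 0 :=
    le_antisymm ((integral_le_l1norm μ hξ y).trans h.le) (integral_nonneg fun _ => norm_nonneg _)
  have h2 := (integral_eq_zero_iff_of_nonneg (fun _ => norm_nonneg _)
    (integrable_left μ hξ y).norm).1 h1
  have h3 := (continuous_left hξ y).norm.ae_eq_iff_eq μ continuous_const |>.1 h2
  exact norm_eq_zero.1 (congrFun h3 g)

end

section

variable [IsTopologicalGroup G] [ContinuousSMul G Y]

theorem isSection_conv_integrand {ξ η : G → ∀ y, B y} (hξ : ξ ∈ E.sectionsCompact)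
    (hη : η ∈ E.sectionsCompact) :
    E.IsSection (fun q : G × G × Y => q.2.2) fun q => ξ q.1 q.2.2 *
      E.act q.1 (smul_inv_smul q.1 q.2.2) (η (q.1⁻¹ * q.2.1) (q.1⁻¹ • q.2.2)) := by
  refine USCField.IsSection.mul (by fun_prop)
    (hξ.1.comp (q := fun q : G × G × Y => (q.1, q.2.2)) (by fun_prop)) ?_
  exact E.isSection_act' (W := G × G × Y) (g := fun q => q.1) (r := fun q => q.2.2)
    (by fun_prop) (by fun_prop)
    (hη.1.comp (q := fun q : G × G × Y => (q.1⁻¹ * q.2.1, q.1⁻¹ • q.2.2)) (by fun_prop))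

/-- For fixed `y`, the function `(h, g) ↦ α_h (η (h⁻¹ g, h⁻¹ y))` is continuous into `B y`. -/
theorem continuous_act_right {η : G → ∀ y, B y} (hη : η ∈ E.sectionsCompact) (y : Y) :
    Continuous fun q : G × G =>
      E.act q.1 (smul_inv_smul q.1 y) (η (q.1⁻¹ * q.2) (q.1⁻¹ • y)) :=
  USCField.IsSection.continuous (F := E.toUSCField) (y := y)
    (E.isSection_act' (W := G × G) (g := fun q => q.1) (r := fun _ => y)
    (by fun_prop) (by fun_prop)
    (hη.1.comp (q := fun q : G × G => (q.1⁻¹ * q.2, q.1⁻¹ • y)) (by fun_prop)))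

variable [T2Space G] [BorelSpace G] [IsFiniteMeasureOnCompacts μ] [∀ y, CompleteSpace (B y)]

theorem conv_mem {ξ η : G → ∀ y, B y} (hξ : ξ ∈ E.sectionsCompact)
    (hη : η ∈ E.sectionsCompact) : E.conv μ ξ η ∈ E.sectionsCompact := by
  obtain ⟨L, hL, h2⟩ := exists_compact_left hξ
  refine ⟨USCField.IsSection.integral μ (F := E.toUSCField) (p := fun q : G × Y => q.2)
    (isSection_conv_integrand hξ hη) hL fun g z hg => by
      rw [h2 g _ hg, zero_mul], ?_⟩
  obtain ⟨-, K, hK, h1⟩ := hξ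
  obtain ⟨-, K', hK', h1'⟩ := hη
  refine ⟨((fun q : (G × Y) × (G × Y) => (q.1.1 * q.2.1, q.1.2)) '' (K ×ˢ K')),
    (hK.prod hK').image (by fun_prop), fun g y hg => ?_⟩
  refine integral_eq_zero_of_ae (Eventually.of_forall fun h => ?_)
  by_cases h3 : (h, y) ∈ K
  · by_cases h4 : (h⁻¹ * g, h⁻¹ • y) ∈ K'
    · exact (hg ⟨((h, y), (h⁻¹ * g, h⁻¹ • y)), ⟨h3, h4⟩, by simp⟩).elim
    · simp [h1' _ _ h4]
  · simp [h1 _ _ h3]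

/-- For fixed `y`, the integrand of the convolution has compact support in `G × G`. -/
theorem exists_compact_conv {ξ η : G → ∀ y, B y} (hξ : ξ ∈ E.sectionsCompact)
    (hη : η ∈ E.sectionsCompact) (y : Y) : ∃ L : Set (G × G), IsCompact L ∧ ∀ q : G × G, q ∉ L →
      (ξ q.1 y = 0 ∨ E.act q.1 (smul_inv_smul q.1 y) (η (q.1⁻¹ * q.2) (q.1⁻¹ • y)) = 0) := by
  obtain ⟨L, hL, h⟩ := exists_compact_left hξ
  obtain ⟨L', hL', h'⟩ := exists_compact_left hη
  refine ⟨(fun q : G × G => (q.1, q.1 * q.2)) '' (L ×ˢ L'), (hL.prod hL').image (by fun_prop),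
    fun q hq => ?_⟩
  by_cases h1 : q.1 ∈ L
  · by_cases h2 : q.1⁻¹ * q.2 ∈ L'
    · exact (hq ⟨(q.1, q.1⁻¹ * q.2), ⟨h1, h2⟩, by simp⟩).elim
    · right; rw [h' _ _ h2, map_zero]
  · left; exact h _ _ h1

theorem integrable_conv {ξ η : G → ∀ y, B y} (hξ : ξ ∈ E.sectionsCompact)
    (hη : η ∈ E.sectionsCompact) (g : G) (y : Y) : Integrable (fun h => ξ h y *
      E.act h (smul_inv_smul h y) (η (h⁻¹ * g) (h⁻¹ • y))) μ := by
  obtain ⟨L, hL, h⟩ := exists_compact_left hξ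
  refine Continuous.integrable_of_hasCompactSupport ?_
    (HasCompactSupport.intro hL fun k hk => by rw [h k y hk, zero_mul])
  exact (continuous_left hξ y).mul
    ((continuous_act_right hη y).comp (g := _) (f := fun h => (h, g)) (by fun_prop))

theorem l1norm_conv_le [μ.IsMulLeftInvariant] {ξ η : G → ∀ y, B y} (hξ : ξ ∈ E.sectionsCompact)
    (hη : η ∈ E.sectionsCompact) : l1norm μ (E.conv μ ξ η) ≤ l1norm μ ξ * l1norm μ η := by
  refine Real.iSup_le (fun y => ?_) (mul_nonneg (l1norm_nonneg μ ξ) (l1norm_nonneg μ η))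
  set T : G → G → B y := fun h g => E.act h (smul_inv_smul h y) (η (h⁻¹ * g) (h⁻¹ • y)) with hT
  have hTc : Continuous (Function.uncurry T) := continuous_act_right hη y
  have hc : Continuous (Function.uncurry fun h g => ‖ξ h y‖ * ‖T h g‖) :=
    ((continuous_left hξ y).comp continuous_fst).norm.mul hTc.norm
  obtain ⟨L, hL, h1⟩ := exists_compact_conv hξ hη y
  have hs : HasCompactSupport (Function.uncurry fun h g => ‖ξ h y‖ * ‖T h g‖) :=
    HasCompactSupport.intro hL fun q hq => by
      rcases h1 q hq with h | h
      · simp [Function.uncurry, h]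
      · simp [Function.uncurry, hT, h]
  have hint (h : G) : ∫ g, ‖T h g‖ ∂μ ≤ l1norm μ η := by
    simp only [hT, E.norm_act]
    rw [integral_mul_left_eq_self (fun g => ‖η g (h⁻¹ • y)‖) h⁻¹]
    exact integral_le_l1norm μ hη _
  have hnn (h : G) : 0 ≤ ∫ g, ‖T h g‖ ∂μ := integral_nonneg fun _ => norm_nonneg _
  have hsw := integral_integral_swap_of_hasCompactSupport hc hs (μ := μ) (ν := μ)
  simp only [integral_const_mul] at hsw
  have hi1 : Integrable (fun g => ∫ h, ‖ξ h y‖ * ‖T h g‖ ∂μ) μ := by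
    refine Continuous.integrable_of_hasCompactSupport ?_
      (HasCompactSupport.intro (hL.image continuous_snd) fun g hg => ?_)
    · obtain ⟨K, hK, h2⟩ := exists_compact_left hξ
      rw [← continuousOn_univ]
      exact continuousOn_integral_of_compact_support hK
        (f := fun g h => ‖ξ h y‖ * ‖T h g‖) (hc.comp continuous_swap).continuousOn
        fun g h _ hh => by simp [h2 h y hh]
    · refine integral_eq_zero_of_ae (Eventually.of_forall fun h => ?_)
      rcases h1 (h, g) (fun h' => hg ⟨_, h', rfl⟩) with h3 | h3
      · simp only [] at h3; simp [h3]
      · simp only [] at h3; simp [hT, h3]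
  have hi2 : Integrable (fun h => ‖ξ h y‖ * ∫ g, ‖T h g‖ ∂μ) μ := by
    refine Continuous.integrable_of_hasCompactSupport ?_ ?_
    · rw [← continuousOn_univ]
      refine (continuousOn_integral_of_compact_support (hL.image continuous_snd) (μ := μ)
        (f := fun h g => ‖ξ h y‖ * ‖T h g‖) (s := univ) hc.continuousOn
        fun h g _ hg => ?_).congr fun h _ => (integral_const_mul _ _).symm
      rcases h1 (h, g) (fun h' => hg ⟨_, h', rfl⟩) with h3 | h3
      · simp only [] at h3; simp [h3]
      · simp only [] at h3; simp [hT, h3]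
    · obtain ⟨K, hK, h2⟩ := exists_compact_left hξ
      exact HasCompactSupport.intro hK fun h hh => by simp [h2 h y hh]
  calc ∫ g, ‖E.conv μ ξ η g y‖ ∂μ ≤ ∫ g, ∫ h, ‖ξ h y‖ * ‖T h g‖ ∂μ ∂μ := by
        refine integral_mono (integrable_left μ (conv_mem μ hξ hη) y).norm hi1 fun g => ?_
        refine norm_integral_le_of_norm_le ?_ (Eventually.of_forall fun h => norm_mul_le _ _)
        refine Continuous.integrable_of_hasCompactSupport
          (hc.comp (g := Function.uncurry fun h g => ‖ξ h y‖ * ‖T h g‖) (f := fun h => (h, g))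
            (by fun_prop)) ?_
        obtain ⟨K, hK, h2⟩ := exists_compact_left hξ
        exact HasCompactSupport.intro hK fun h hh => by simp [h2 h y hh]
    _ = ∫ h, ‖ξ h y‖ * ∫ g, ‖T h g‖ ∂μ ∂μ := hsw.symm
    _ ≤ ∫ h, ‖ξ h y‖ * l1norm μ η ∂μ :=
        integral_mono hi2 ((integrable_left μ hξ y).norm.mul_const _)
          fun h => mul_le_mul_of_nonneg_left (hint h) (norm_nonneg _)
    _ = (∫ h, ‖ξ h y‖ ∂μ) * l1norm μ η := integral_mul_const _ _
    _ ≤ _ := mul_le_mul_of_nonneg_right (integral_le_l1norm μ hξ y) (l1norm_nonneg μ η)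

theorem conv_add {ξ η θ : G → ∀ y, B y} (hξ : ξ ∈ E.sectionsCompact) (hη : η ∈ E.sectionsCompact)
    (hθ : θ ∈ E.sectionsCompact) :
    E.conv μ ξ (η + θ) = E.conv μ ξ η + E.conv μ ξ θ := by
  funext g y
  simp only [conv, Pi.add_apply, map_add, mul_add]
  exact integral_add (integrable_conv μ hξ hη g y) (integrable_conv μ hξ hθ g y)

theorem add_conv {ξ η θ : G → ∀ y, B y} (hξ : ξ ∈ E.sectionsCompact) (hη : η ∈ E.sectionsCompact)
    (hθ : θ ∈ E.sectionsCompact) :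
    E.conv μ (ξ + η) θ = E.conv μ ξ θ + E.conv μ η θ := by
  funext g y
  simp only [conv, Pi.add_apply, add_mul]
  exact integral_add (integrable_conv μ hξ hθ g y) (integrable_conv μ hη hθ g y)

variable [∀ y, IsScalarTower ℂ (B y) (B y)] [∀ y, SMulCommClass ℂ (B y) (B y)]

theorem conv_smul (c : ℂ) (ξ η : G → ∀ y, B y) : E.conv μ ξ (c • η) = c • E.conv μ ξ η := by
  funext g y
  simp only [conv, Pi.smul_apply, map_smul, mul_smul_comm]
  exact integral_smul c _

theorem smul_conv (c : ℂ) (ξ η : G → ∀ y, B y) : E.conv μ (c • ξ) η = c • E.conv μ ξ η := by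
  funext g y
  simp only [conv, Pi.smul_apply, smul_mul_assoc]
  exact integral_smul c _

theorem conv_assoc [μ.IsMulLeftInvariant] {ξ η θ : G → ∀ y, B y} (hξ : ξ ∈ E.sectionsCompact)
    (hη : η ∈ E.sectionsCompact) (hθ : θ ∈ E.sectionsCompact) :
    E.conv μ (E.conv μ ξ η) θ = E.conv μ ξ (E.conv μ η θ) := by
  funext g y
  set T : G → G → B y := fun h k => E.act h (smul_inv_smul h y) (η (h⁻¹ * k) (h⁻¹ • y)) with hT
  set S : G → B y := fun k => E.act k (smul_inv_smul k y) (θ (k⁻¹ * g) (k⁻¹ • y)) with hS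
  have hTc : Continuous (Function.uncurry T) := continuous_act_right hη y
  have hSc : Continuous S :=
    (continuous_act_right hθ y).comp (g := _) (f := fun h => (h, g)) (by fun_prop)
  obtain ⟨L, hL, h1⟩ := exists_compact_conv hξ hη y
  have hc : Continuous (Function.uncurry fun k h => ξ h y * T h k * S k) :=
    (((continuous_left hξ y).comp continuous_snd).mul (hTc.comp continuous_swap)).mul
      (hSc.comp continuous_fst)
  have hs : HasCompactSupport (Function.uncurry fun k h => ξ h y * T h k * S k) := by
    refine HasCompactSupport.intro (hL.image continuous_swap) fun q hq => ?_
    rcases h1 q.swap (fun h' => hq ⟨_, h', rfl⟩) with h3 | h3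
    · simp only [Prod.fst_swap] at h3
      simp [Function.uncurry, h3]
    · simp only [Prod.fst_swap, Prod.snd_swap] at h3
      simp [Function.uncurry, hT, h3]
  calc E.conv μ (E.conv μ ξ η) θ g y = ∫ k, (∫ h, ξ h y * T h k * S k ∂μ) ∂μ := by
        refine integral_congr_ae (Eventually.of_forall fun k => ?_)
        show (∫ h, ξ h y * T h k ∂μ) * S k = _
        exact (((ContinuousLinearMap.mul ℂ (B y)).flip (S k)).integral_comp_comm
          (integrable_conv μ hξ hη k y)).symm
    _ = ∫ h, (∫ k, ξ h y * T h k * S k ∂μ) ∂μ :=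
        integral_integral_swap_of_hasCompactSupport hc hs
    _ = E.conv μ ξ (E.conv μ η θ) g y := by
        refine integral_congr_ae (Eventually.of_forall fun h => ?_)
        show ∫ k, ξ h y * T h k * S k ∂μ = ξ h y * E.act h (smul_inv_smul h y)
          (E.conv μ η θ (h⁻¹ * g) (h⁻¹ • y))
        have h2 : ∀ k, T h (h * k) * S (h * k) = E.act h (smul_inv_smul h y) (η k (h⁻¹ • y) *
            E.act k (smul_inv_smul k (h⁻¹ • y)) (θ (k⁻¹ * (h⁻¹ * g)) (k⁻¹ • h⁻¹ • y))) := by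
          intro k
          have h4 : (h * k) • k⁻¹ • h⁻¹ • y = y := by simp [mul_smul]
          rw [map_mul, ← E.act_mul h k _ _ h4]
          simp only [hT, hS, inv_mul_cancel_left, mul_inv_rev, mul_assoc]
          congr 1
          exact E.act_congr (fun z => θ (k⁻¹ * (h⁻¹ * g)) z) _ _ _
        have h5 : ∫ k, T h k * S k ∂μ = E.act h (smul_inv_smul h y)
            (E.conv μ η θ (h⁻¹ * g) (h⁻¹ • y)) := by
          rw [← integral_mul_left_eq_self _ h]
          simp only [h2]
          exact (E.actL h (smul_inv_smul h y)).integral_comp_comm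
            (integrable_conv μ hη hθ (h⁻¹ * g) (h⁻¹ • y))
        rw [← h5]
        have h6 : Integrable (fun k => T h k * S k) μ := by
          refine Continuous.integrable_of_hasCompactSupport
            ((hTc.comp (g := Function.uncurry T) (f := fun k => (h, k)) (by fun_prop)).mul hSc) ?_
          obtain ⟨K, hK, h7⟩ := exists_compact_left hη
          refine HasCompactSupport.intro (hK.image (continuous_const_mul h)) fun k hk => ?_
          have : h⁻¹ * k ∉ K := fun h8 => hk ⟨_, h8, by simp⟩
          simp [hT, h7 _ _ this]
        simp only [mul_assoc]
        exact (ContinuousLinearMap.mul ℂ (B y) (ξ h y)).integral_comp_comm h6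

end

end EquivariantField

end Equivariant

section Completion

variable (X : Type*) [NonUnitalNormedRing X]

open UniformSpace UniformSpace.Completion

/-- The product of the completion of a normed algebra, extended by continuity. -/
noncomputable abbrev complMul : Mul (Completion X) :=
  ⟨Function.curry <| (isDenseInducing_coe.prodMap isDenseInducing_coe).extend
    ((↑) ∘ Function.uncurry ((· * ·) : X → X → X))⟩

attribute [local instance] complMul

theorem compl_coe_mul (a b : X) : ((a * b : X) : Completion X) = a * b :=
  ((isDenseInducing_coe.prodMap isDenseInducing_coe).extend_eq
    ((continuous_coe X).comp (continuous_mul (M := X))) (a, b)).symm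

theorem compl_continuous_mul : ContinuousMul (Completion X) where
  continuous_mul := by
    let m := (AddMonoidHom.mul : X →+ X →+ X).compr₂ toCompl
    have : Continuous fun p : X × X => m p.1 p.2 := (continuous_coe X).comp continuous_mul
    have di : IsDenseInducing (toCompl : X → Completion X) := isDenseInducing_coe
    exact (di.extend_Z_bilin di this :)

attribute [local instance] compl_continuous_mul

/-- The completion of a (non-unital) normed ring. -/
noncomputable abbrev complRing : NonUnitalNormedRing (Completion X) where
  __ : NormedAddCommGroup (Completion X) := inferInstance
  __ : Mul (Completion X) := complMul X
  zero_mul a := Completion.induction_on a (isClosed_eq (by fun_prop) continuous_const)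
    fun a => by rw [← coe_zero, ← compl_coe_mul, zero_mul]
  mul_zero a := Completion.induction_on a (isClosed_eq (by fun_prop) continuous_const)
    fun a => by rw [← coe_zero, ← compl_coe_mul, mul_zero]
  mul_assoc a b c := Completion.induction_on₃ a b c (isClosed_eq (by fun_prop) (by fun_prop))
    fun a b c => by
      rw [← compl_coe_mul, ← compl_coe_mul, ← compl_coe_mul, ← compl_coe_mul, mul_assoc]
  left_distrib a b c := Completion.induction_on₃ a b c (isClosed_eq (by fun_prop) (by fun_prop))
    fun a b c => by
      rw [← coe_add, ← compl_coe_mul, ← compl_coe_mul, ← compl_coe_mul, ← coe_add, mul_add]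
  right_distrib a b c := Completion.induction_on₃ a b c (isClosed_eq (by fun_prop) (by fun_prop))
    fun a b c => by
      rw [← coe_add, ← compl_coe_mul, ← compl_coe_mul, ← compl_coe_mul, ← coe_add, add_mul]
  norm_mul_le x y := by
    induction x, y using induction_on₂ with
    | hp => apply isClosed_le <;> fun_prop
    | ih x y => simpa only [← compl_coe_mul, norm_coe] using norm_mul_le x y

attribute [local instance] complRing

variable [NormedSpace ℂ X]

theorem compl_isScalarTower [IsScalarTower ℂ X X] :
    IsScalarTower ℂ (Completion X) (Completion X) where
  smul_assoc c x y := by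
    show (c • x) * y = c • (x * y)
    refine Completion.induction_on₂ x y (isClosed_eq ?_ ?_) fun x y => ?_
    · exact ((continuous_const_smul c).comp continuous_fst).mul continuous_snd
    · exact (continuous_const_smul c).comp (continuous_fst.mul continuous_snd)
    · rw [← coe_smul, ← compl_coe_mul, ← compl_coe_mul, ← coe_smul, smul_mul_assoc]

theorem compl_smulCommClass [SMulCommClass ℂ X X] :
    SMulCommClass ℂ (Completion X) (Completion X) where
  smul_comm c x y := by
    show c • (x * y) = x * (c • y)
    refine Completion.induction_on₂ x y (isClosed_eq ?_ ?_) fun x y => ?_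
    · exact (continuous_const_smul c).comp (continuous_fst.mul continuous_snd)
    · exact continuous_fst.mul ((continuous_const_smul c).comp continuous_snd)
    · rw [← coe_smul, ← compl_coe_mul, ← compl_coe_mul, ← coe_smul, mul_smul_comm]

end Completion

section L1

variable {G Y : Type*} [Group G] [TopologicalSpace G] [IsTopologicalGroup G] [T2Space G]
  [MeasurableSpace G] [BorelSpace G] [TopologicalSpace Y] [MulAction G Y] [ContinuousSMul G Y]
  {B : Y → Type*} [∀ y, NonUnitalNormedRing (B y)] [∀ y, NormedSpace ℂ (B y)]
  [∀ y, IsScalarTower ℂ (B y) (B y)] [∀ y, SMulCommClass ℂ (B y) (B y)] [∀ y, CompleteSpace (B y)]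

namespace EquivariantField

/-- `Γ_c(G ⋉ Y, r^* B)` as a normed algebra, with convolution and the norm of `L¹(G ⋉ Y, B)`. -/
def ConvAlg (E : EquivariantField G B) (_μ : Measure G) : Type _ := E.sectionsCompact

variable (E : EquivariantField G B) (μ : Measure G)

noncomputable instance : AddCommGroup (E.ConvAlg μ) :=
  inferInstanceAs (AddCommGroup E.sectionsCompact)

noncomputable instance : Module ℂ (E.ConvAlg μ) := inferInstanceAs (Module ℂ E.sectionsCompact)

variable [μ.IsHaarMeasure]

noncomputable instance : NormedAddCommGroup (E.ConvAlg μ) :=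
  AddGroupNorm.toNormedAddCommGroup
    { toFun := fun ξ => l1norm μ ξ.1
      map_zero' := by
        show l1norm μ (0 : G → ∀ y, B y) = 0
        simp [l1norm]
      add_le' := fun ξ η => l1norm_add_le μ ξ.2 η.2
      neg' := fun ξ => by
        show l1norm μ (-ξ.1) = l1norm μ ξ.1
        simp [l1norm]
      eq_zero_of_map_eq_zero' := fun ξ h => Subtype.ext (eq_zero_of_l1norm μ ξ.2 h) }

theorem convAlg_norm_def (ξ : E.ConvAlg μ) : ‖ξ‖ = ⨆ y, ∫ g, ‖ξ.1 g y‖ ∂μ := rfl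

noncomputable instance : NormedSpace ℂ (E.ConvAlg μ) where
  norm_smul_le c ξ := (l1norm_smul μ c ξ.1).le

noncomputable instance : Mul (E.ConvAlg μ) := ⟨fun ξ η => ⟨E.conv μ ξ.1 η.1, conv_mem μ ξ.2 η.2⟩⟩

noncomputable instance : NonUnitalNormedRing (E.ConvAlg μ) where
  __ : NormedAddCommGroup (E.ConvAlg μ) := inferInstance
  __ : Mul (E.ConvAlg μ) := inferInstance
  left_distrib ξ η θ := Subtype.ext (conv_add μ ξ.2 η.2 θ.2)
  right_distrib ξ η θ := Subtype.ext (add_conv μ ξ.2 η.2 θ.2)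
  zero_mul ξ := Subtype.ext (by
    show E.conv μ (0 : G → ∀ y, B y) ξ.1 = 0
    simpa using smul_conv (E := E) μ 0 0 ξ.1)
  mul_zero ξ := Subtype.ext (by
    show E.conv μ ξ.1 (0 : G → ∀ y, B y) = 0
    simpa using conv_smul (E := E) μ 0 ξ.1 0)
  mul_assoc ξ η θ := Subtype.ext (conv_assoc μ ξ.2 η.2 θ.2)
  norm_mul_le ξ η := l1norm_conv_le μ ξ.2 η.2

instance : IsScalarTower ℂ (E.ConvAlg μ) (E.ConvAlg μ) where
  smul_assoc c ξ η := Subtype.ext (smul_conv μ c ξ.1 η.1)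

instance : SMulCommClass ℂ (E.ConvAlg μ) (E.ConvAlg μ) where
  smul_comm c ξ η := Subtype.ext (conv_smul μ c ξ.1 η.1).symm

/-- The Banach algebra `L¹(G ⋉ Y, B)`. -/
abbrev L1 : Type _ := UniformSpace.Completion (E.ConvAlg μ)

noncomputable instance : NonUnitalNormedRing (E.L1 μ) := complRing (E.ConvAlg μ)

instance : IsScalarTower ℂ (E.L1 μ) (E.L1 μ) := compl_isScalarTower (E.ConvAlg μ)

instance : SMulCommClass ℂ (E.L1 μ) (E.L1 μ) := compl_smulCommClass (E.ConvAlg μ)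

end EquivariantField

end L1

section Gamma0

variable {Y : Type*} [TopologicalSpace Y] {B : Y → Type*} [∀ y, NonUnitalNormedRing (B y)]
  [∀ y, NormedSpace ℂ (B y)] [∀ y, IsScalarTower ℂ (B y) (B y)]
  [∀ y, SMulCommClass ℂ (B y) (B y)]

/-- A family of elements of the fibres vanishes at infinity. -/
def VanishesAtInfty (ξ : ∀ y, B y) : Prop :=
  ∀ ε > 0, ∃ K : Set Y, IsCompact K ∧ ∀ y ∉ K, ‖ξ y‖ ≤ ε

/-- `Γ₀(Y, B)`: the Banach algebra of sections vanishing at infinity, with the supremum norm. -/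
def USCField.Gamma0 (F : USCField B) : NonUnitalSubalgebra ℂ (lp B ∞) where
  carrier := {f | (f : ∀ y, B y) ∈ F.sections ∧ VanishesAtInfty (f : ∀ y, B y)}
  zero_mem' := ⟨F.sections.zero_mem, fun ε hε => ⟨∅, isCompact_empty, fun y _ => by simpa using hε.le⟩⟩
  add_mem' := by
    rintro f g ⟨hf, hf'⟩ ⟨hg, hg'⟩
    refine ⟨F.sections.add_mem hf hg, fun ε hε => ?_⟩
    obtain ⟨K, hK, h1⟩ := hf' (ε / 2) (half_pos hε)
    obtain ⟨L, hL, h2⟩ := hg' (ε / 2) (half_pos hε)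
    refine ⟨K ∪ L, hK.union hL, fun y hy => ?_⟩
    have h3 := h1 y fun h => hy (Or.inl h)
    have h4 := h2 y fun h => hy (Or.inr h)
    exact (norm_add_le (f y) (g y)).trans (by linarith)
  smul_mem' := by
    rintro c f ⟨hf, hf'⟩
    refine ⟨F.sections.smul_mem c hf, fun ε hε => ?_⟩
    obtain ⟨K, hK, h1⟩ := hf' (ε / (‖c‖ + 1)) (by positivity)
    refine ⟨K, hK, fun y hy => ?_⟩
    calc ‖c • f y‖ = ‖c‖ * ‖f y‖ := norm_smul _ _
      _ ≤ (‖c‖ + 1) * (ε / (‖c‖ + 1)) := by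
        gcongr
        · linarith
        · exact h1 y hy
      _ = ε := by field_simp
  mul_mem' := by
    rintro f g ⟨hf, hf'⟩ ⟨hg, hg'⟩
    refine ⟨F.mul_mem _ hf _ hg, fun ε hε => ?_⟩
    obtain ⟨K, hK, h1⟩ := hf' (ε / (‖g‖ + 1)) (by positivity)
    refine ⟨K, hK, fun y hy => ?_⟩
    calc ‖f y * g y‖ ≤ ‖f y‖ * ‖g y‖ := norm_mul_le _ _
      _ ≤ (ε / (‖g‖ + 1)) * (‖g‖ + 1) := by
        gcongr
        · exact h1 y hy
        · exact (lp.norm_apply_le_norm ENNReal.top_ne_zero g y).trans (by linarith)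
      _ = ε := by field_simp

variable {F : USCField B}

/-- The element of `Γ₀(Y, B)` given by a section vanishing at infinity. -/
def USCField.Gamma0.mk (ξ : ∀ y, B y) (h : ξ ∈ F.sections) (h' : VanishesAtInfty ξ) : F.Gamma0 :=
  ⟨⟨ξ, memℓp_infty (by
    obtain ⟨K, hK, h1⟩ := h' 1 one_pos
    obtain ⟨C, h0, hC⟩ := (USCField.isSection_of_mem h (fun y : Y => y)).exists_bound
      continuous_id hK
    refine ⟨max C 1, ?_⟩
    rintro _ ⟨y, rfl⟩
    by_cases hy : y ∈ K
    · exact (hC y hy).trans (le_max_left _ _)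
    · exact (h1 y hy).trans (le_max_right _ _))⟩, h, h'⟩

theorem USCField.Gamma0.norm_apply_le (f : F.Gamma0) (y : Y) : ‖f.1 y‖ ≤ ‖f‖ :=
  lp.norm_apply_le_norm ENNReal.top_ne_zero f.1 y

theorem USCField.Gamma0.norm_le {f : F.Gamma0} {C : ℝ} (hC : 0 ≤ C) (h : ∀ y, ‖f.1 y‖ ≤ C) :
    ‖f‖ ≤ C :=
  lp.norm_le_of_forall_le hC h

noncomputable instance : NormedSpace ℂ F.Gamma0 where
  norm_smul_le c f := norm_smul_le c f.1

instance [∀ y, CompleteSpace (B y)] : CompleteSpace F.Gamma0 := by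
  have hcl : IsClosed (F.Gamma0 : Set (lp B ∞)) := isClosed_of_closure_subset fun f hf => ?_
  · exact hcl.completeSpace_coe
  have key (ε : ℝ) (hε : 0 < ε) : ∃ g ∈ F.Gamma0, ∀ y, ‖f y - g y‖ ≤ ε := by
    obtain ⟨g, hg, h⟩ := Metric.mem_closure_iff.1 hf ε hε
    refine ⟨g, hg, fun y => ?_⟩
    rw [dist_eq_norm] at h
    exact (lp.norm_apply_le_norm ENNReal.top_ne_zero (f - g) y).trans h.le
  refine ⟨F.mem_of_locally_approx _ fun y ε hε => ?_, fun ε hε => ?_⟩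
  · obtain ⟨g, hg, h⟩ := key ε hε
    exact ⟨_, hg.1, Eventually.of_forall h⟩
  · obtain ⟨g, hg, h⟩ := key (ε / 2) (half_pos hε)
    obtain ⟨K, hK, h1⟩ := hg.2 (ε / 2) (half_pos hε)
    refine ⟨K, hK, fun y hy => ?_⟩
    calc ‖f y‖ = ‖(f y - g y) + g y‖ := by rw [sub_add_cancel]
      _ ≤ ε := (norm_add_le _ _).trans (by linarith [h y, h1 y hy])

end Gamma0

section Pushforward

variable {G Y : Type*} [Group G] [TopologicalSpace G] [IsTopologicalGroup G]
  [TopologicalSpace Y] [MulAction G Y] [ContinuousSMul G Y]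
  {B : Y → Type*} [∀ y, NonUnitalNormedRing (B y)] [∀ y, NormedSpace ℂ (B y)]
  [∀ y, IsScalarTower ℂ (B y) (B y)] [∀ y, SMulCommClass ℂ (B y) (B y)]

namespace EquivariantField

variable (E : EquivariantField G B)

/-- The action of `G` on sections, `(g ξ)(y) = α_{(g, y)} (ξ (g⁻¹ y))`. -/
def actSection (g : G) (ξ : ∀ y, B y) : ∀ y, B y := fun y =>
  E.act g (smul_inv_smul g y) (ξ (g⁻¹ • y))

theorem isSection_actSection {ξ : ∀ y, B y} (hξ : ξ ∈ E.sections) :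
    E.IsSection (fun q : G × Y => q.2) fun q => E.actSection q.1 ξ q.2 :=
  E.isSection_act _ (USCField.isSection_of_mem hξ _)

theorem actSection_mem (g : G) {ξ : ∀ y, B y} (hξ : ξ ∈ E.sections) :
    E.actSection g ξ ∈ E.sections :=
  USCField.mem_of_isSection
    ((E.isSection_actSection hξ).comp (q := fun y : Y => (g, y)) (by fun_prop))

theorem vanishes_actSection (g : G) {ξ : ∀ y, B y} (hξ : VanishesAtInfty ξ) :
    VanishesAtInfty (E.actSection g ξ) := fun ε hε => by
  obtain ⟨K, hK, h⟩ := hξ ε hε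
  refine ⟨(fun y => g • y) '' K, hK.image (continuous_const_smul g), fun y hy => ?_⟩
  rw [actSection, E.norm_act]
  exact h _ fun h' => hy ⟨_, h', smul_inv_smul g y⟩

/-- The action of `G` on the Banach algebra `Γ₀(Y, B)`. -/
def actGamma0 (g : G) : E.Gamma0 →ₙₐ[ℂ] E.Gamma0 where
  toFun f := USCField.Gamma0.mk (E.actSection g f.1) (E.actSection_mem g f.2.1)
    (E.vanishes_actSection g f.2.2)
  map_smul' c _ := Subtype.ext (lp.ext (funext fun _ => map_smul (E.act g _) c _))
  map_zero' := Subtype.ext (lp.ext (funext fun _ => map_zero (E.act g _)))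
  map_add' _ _ := Subtype.ext (lp.ext (funext fun _ => map_add (E.act g _) _ _))
  map_mul' _ _ := Subtype.ext (lp.ext (funext fun _ => map_mul (E.act g _) _ _))

theorem actGamma0_apply (g : G) (f : E.Gamma0) (y : Y) :
    (E.actGamma0 g f).1 y = E.act g (smul_inv_smul g y) (f.1 (g⁻¹ • y)) := rfl

theorem norm_actGamma0 (g : G) (f : E.Gamma0) : ‖E.actGamma0 g f‖ = ‖f‖ := by
  refine le_antisymm (USCField.Gamma0.norm_le (norm_nonneg f) fun y => ?_)
    (USCField.Gamma0.norm_le (norm_nonneg _) fun y => ?_)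
  · rw [actGamma0_apply, E.norm_act]
    exact USCField.Gamma0.norm_apply_le f _
  · have h := USCField.Gamma0.norm_apply_le (E.actGamma0 g f) (g • y)
    rw [actGamma0_apply, E.norm_act, inv_smul_smul] at h
    exact h

theorem eventually_norm_lt {ζ : G → ∀ y, B y}
    (hζ : E.IsSection (fun q : G × Y => q.2) fun q => ζ q.1 q.2) {g₀ : G} (h0 : ∀ y, ζ g₀ y = 0)
    {L : Set Y} (hL : IsCompact L) {ε : ℝ} (hε : 0 < ε) : ∀ᶠ g in 𝓝 g₀, ∀ y ∈ L, ‖ζ g y‖ < ε :=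
  hL.eventually_forall_of_forall_eventually fun y _ =>
    hζ.norm_lt (z := (g₀, y)) continuous_snd (by simpa [h0] using hε)

theorem eventually_actGamma0 [LocallyCompactSpace G] (f : E.Gamma0) (g₀ : G) {ε : ℝ}
    (hε : 0 < ε) : ∀ᶠ g in 𝓝 g₀, ‖E.actGamma0 g f - E.actGamma0 g₀ f‖ ≤ ε := by
  obtain ⟨K, hK, h1⟩ := f.2.2 (ε / 2) (half_pos hε)
  obtain ⟨N, hN, hN'⟩ := exists_compact_mem_nhds g₀
  have hL : IsCompact ((fun q : G × Y => q.1 • q.2) '' (N ×ˢ K)) :=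
    (hN.prod hK).image (by fun_prop)
  have hζ : E.IsSection (fun q : G × Y => q.2)
      fun q => E.actSection q.1 f.1 q.2 - E.actSection g₀ f.1 q.2 :=
    (E.isSection_actSection f.2.1).sub
      ((E.isSection_actSection f.2.1).comp (q := fun q : G × Y => (g₀, q.2)) (by fun_prop))
  have h2 := E.eventually_norm_lt (ζ := fun g y => E.actSection g f.1 y - E.actSection g₀ f.1 y)
    hζ (g₀ := g₀) (fun y => sub_self _) hL hε
  filter_upwards [h2, hN'] with g hg hgN
  refine USCField.Gamma0.norm_le hε.le fun y => ?_
  show ‖E.actSection g f.1 y - E.actSection g₀ f.1 y‖ ≤ ε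
  by_cases hy : y ∈ (fun q : G × Y => q.1 • q.2) '' (N ×ˢ K)
  · exact (hg y hy).le
  · have h3 : ∀ k ∈ N, ‖E.actSection k f.1 y‖ ≤ ε / 2 := fun k hk => by
      rw [actSection, E.norm_act]
      exact h1 _ fun h4 => hy ⟨(k, k⁻¹ • y), ⟨hk, h4⟩, smul_inv_smul k y⟩
    exact (norm_sub_le _ _).trans (by linarith [h3 g hgN, h3 g₀ (mem_of_mem_nhds hN')])

/-- The `G`-Banach algebra `ρ_* B = Γ₀(Y, B)`, obtained by forgetting the fibration over `Y`; the
group `G` is regarded as the groupoid `G ⋉ {pt}`. -/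
noncomputable def pushforward [LocallyCompactSpace G] : EquivariantField G (fun _ : Unit => E.Gamma0) where
  sections := ⊤
  dense_values _ := by
    have : {b : E.Gamma0 | ∃ ξ ∈ (⊤ : Submodule ℂ (Unit → E.Gamma0)), ξ () = b} = univ :=
      eq_univ_of_forall fun b => ⟨fun _ => b, trivial, rfl⟩
    rw [this]
    exact dense_univ
  upperSemicontinuous_norm _ _ := continuous_of_discreteTopology.upperSemicontinuous
  mem_of_locally_approx _ _ := trivial
  mul_mem _ _ _ _ := trivial
  act g _ _ _ := E.actGamma0 g
  norm_act g _ _ _ f := E.norm_actGamma0 g f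
  act_one _ f := Subtype.ext (lp.ext (funext fun y => by
    rw [actGamma0_apply, E.act_congr f.1 1 (smul_inv_smul 1 y) (one_smul G y), E.act_one]))
  act_mul g h _ _ _ _ _ _ f := Subtype.ext (lp.ext (funext fun y => by
    have h4 : (g * h) • h⁻¹ • g⁻¹ • y = y := by simp [mul_smul]
    rw [actGamma0_apply, actGamma0_apply, actGamma0_apply,
      E.act_congr f.1 (g * h) (smul_inv_smul (g * h) y) h4,
      E.act_mul g h (smul_inv_smul h _) (smul_inv_smul g y) h4]))
  isSection_act ζ hζ := by
    rintro ⟨g₀, u⟩ ε hε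
    obtain ⟨η, -, h1⟩ := hζ (g₀, u) (ε / 2) (half_pos hε)
    refine ⟨fun _ => E.actGamma0 g₀ (η ()), trivial, ?_⟩
    have h2 := (E.eventually_actGamma0 (η ()) g₀ (half_pos hε))
    filter_upwards [h1, (continuous_fst.tendsto (g₀, u)).eventually h2] with q h3 h4
    calc ‖E.actGamma0 q.1 (ζ q) - E.actGamma0 g₀ (η ())‖
        = ‖E.actGamma0 q.1 (ζ q - η ()) + (E.actGamma0 q.1 (η ()) - E.actGamma0 g₀ (η ()))‖ := by
          rw [map_sub, sub_add_sub_cancel]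
      _ ≤ ‖E.actGamma0 q.1 (ζ q - η ())‖ + ‖E.actGamma0 q.1 (η ()) - E.actGamma0 g₀ (η ())‖ :=
          norm_add_le _ _
      _ ≤ ε := by
          rw [norm_actGamma0]
          have h3' : ‖ζ q - η ()‖ ≤ ε / 2 := h3
          linarith

theorem section_mem {ξ : G → ∀ y, B y} (hξ : ξ ∈ E.sectionsCompact) (g : G) :
    ξ g ∈ E.sections :=
  USCField.mem_of_isSection (hξ.1.comp (q := fun y : Y => (g, y)) (by fun_prop))

theorem section_vanishes {ξ : G → ∀ y, B y} (hξ : ξ ∈ E.sectionsCompact) (g : G) :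
    VanishesAtInfty (ξ g) := fun ε hε => by
  obtain ⟨-, K, hK, h⟩ := hξ
  refine ⟨Prod.snd '' K, hK.image continuous_snd, fun y hy => ?_⟩
  rw [h g y fun h' => hy ⟨_, h', rfl⟩, norm_zero]
  exact hε.le

/-- The canonical map `Γ_c(G ⋉ Y, r^* B) → C_c(G, Γ₀(Y, B))`, `ξ ↦ (g ↦ ξ(g, ·))`. -/
noncomputable def iota [LocallyCompactSpace G] [MeasurableSpace G] (μ : Measure G) (ξ : E.ConvAlg μ) :
    E.pushforward.ConvAlg μ :=
  ⟨fun g _ => USCField.Gamma0.mk (ξ.1 g) (E.section_mem ξ.2 g) (E.section_vanishes ξ.2 g), by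
    obtain ⟨ξ, hξ⟩ := ξ
    obtain ⟨h, K, hK, h1⟩ := id hξ
    constructor
    · rintro ⟨g₀, u⟩ ε hε
      refine ⟨fun _ => USCField.Gamma0.mk (ξ g₀) (E.section_mem hξ g₀) (E.section_vanishes hξ g₀),
        trivial, ?_⟩
      have h2 := E.eventually_norm_lt (ζ := fun g y => ξ g y - ξ g₀ y)
        (h.sub (h.comp (q := fun q : G × Y => (g₀, q.2)) (by fun_prop))) (g₀ := g₀)
        (fun y => sub_self _) (hK.image continuous_snd) hε
      filter_upwards [(continuous_fst.tendsto (g₀, u)).eventually h2] with q hq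
      refine USCField.Gamma0.norm_le hε.le fun y => ?_
      show ‖ξ q.1 y - ξ g₀ y‖ ≤ ε
      by_cases hy : y ∈ Prod.snd '' K
      · exact (hq y hy).le
      · rw [h1 q.1 y fun h' => hy ⟨_, h', rfl⟩, h1 g₀ y fun h' => hy ⟨_, h', rfl⟩]
        simpa using hε.le
    · refine ⟨(fun q : G × Y => (q.1, ())) '' K, hK.image (by fun_prop), fun g u hg => ?_⟩
      exact Subtype.ext (lp.ext (funext fun y => h1 g y fun h' => hg ⟨_, h', rfl⟩))⟩

end EquivariantField

end Pushforward

end BanachField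

namespace BanachK

/-! ### Dense spectral homomorphisms -/

/-- A continuous ring homomorphism with dense range such that every element whose image is close
to `1` is invertible. -/
structure DenseSpectral {R S : Type*} [Ring R] [Ring S] [TopologicalSpace R] [TopologicalSpace S]
    (φ : R →+* S) : Prop where
  continuous : Continuous φ
  denseRange : DenseRange φ
  isUnit_of_near_one : ∃ U ∈ 𝓝 (1 : S), ∀ x, φ x ∈ U → IsUnit x

theorem denseRange_map_matrix {R S : Type*} [TopologicalSpace S] {φ : R → S} (h : DenseRange φ) {ι κ : Type*} :
    DenseRange fun x : Matrix ι κ R => x.map φ :=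
  DenseRange.piMap fun _ => DenseRange.piMap fun _ => h

section Ring

variable {R S : Type*} [Ring R] [Ring S]

theorem isUnit_of_isUnit_mul {a b c : R} (h : IsUnit (a * b)) (k : IsUnit (c * a)) : IsUnit a := by
  obtain ⟨u, hu⟩ := h
  obtain ⟨v, hv⟩ := k
  refine isUnit_iff_exists_and_exists.2 ⟨⟨b * ↑u⁻¹, ?_⟩, ⟨↑v⁻¹ * c, ?_⟩⟩
  · rw [← mul_assoc, ← hu, Units.mul_inv]
  · rw [mul_assoc, ← hv, Units.inv_mul]

theorem DenseSpectral.isUnit_of_map [TopologicalSpace R] [TopologicalSpace S] [IsTopologicalRing S]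
    {φ : R →+* S} (h : DenseSpectral φ) {x : R} (hx : IsUnit (φ x)) : IsUnit x := by
  obtain ⟨U, hU, h1⟩ := h.isUnit_of_near_one
  obtain ⟨u, hu⟩ := hx
  have hl : ∀ᶠ s in 𝓝 (↑u⁻¹ : S), φ x * s ∈ U := by
    have : ContinuousAt (fun s => φ x * s) (↑u⁻¹ : S) := by fun_prop
    refine this (?_ : U ∈ 𝓝 (φ x * ↑u⁻¹))
    rwa [← hu, Units.mul_inv]
  have hr : ∀ᶠ s in 𝓝 (↑u⁻¹ : S), s * φ x ∈ U := by
    have : ContinuousAt (fun s => s * φ x) (↑u⁻¹ : S) := by fun_prop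
    refine this (?_ : U ∈ 𝓝 (↑u⁻¹ * φ x))
    rwa [← hu, Units.inv_mul]
  obtain ⟨_, ⟨h2, h3⟩, c, rfl⟩ := mem_closure_iff_nhds.1 (h.denseRange (↑u⁻¹ : S)) _ (hl.and hr)
  exact isUnit_of_isUnit_mul (h1 (x * c) (by rwa [map_mul])) (h1 (c * x) (by rwa [map_mul]))

section Blocks

variable {ι κ : Type*} [Fintype ι] [Fintype κ] [DecidableEq ι] [DecidableEq κ]

/-- A block matrix with an invertible upper left corner and an invertible Schur complement is
invertible. -/
theorem isUnit_fromBlocks (a : (Matrix ι ι R)ˣ) (b : Matrix ι κ R) (c : Matrix κ ι R)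
    (d : Matrix κ κ R) (hs : IsUnit (d - c * (↑a⁻¹ : Matrix ι ι R) * b)) :
    IsUnit (Matrix.fromBlocks (a : Matrix ι ι R) b c d) := by
  obtain ⟨s, hs⟩ := hs
  have h1 : IsUnit (Matrix.fromBlocks (1 : Matrix ι ι R) 0 (c * (↑a⁻¹ : Matrix ι ι R))
      (1 : Matrix κ κ R)) :=
    isUnit_iff_exists.2 ⟨Matrix.fromBlocks (1 : Matrix ι ι R) 0 (-(c * (↑a⁻¹ : Matrix ι ι R)))
      (1 : Matrix κ κ R), by rw [Matrix.fromBlocks_multiply]; simp,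
      by rw [Matrix.fromBlocks_multiply]; simp⟩
  have h2 : IsUnit (Matrix.fromBlocks (a : Matrix ι ι R) 0 0 (s : Matrix κ κ R)) :=
    isUnit_iff_exists.2 ⟨Matrix.fromBlocks (↑a⁻¹ : Matrix ι ι R) 0 0 (↑s⁻¹ : Matrix κ κ R),
      by rw [Matrix.fromBlocks_multiply]; simp, by rw [Matrix.fromBlocks_multiply]; simp⟩
  have h3 : IsUnit (Matrix.fromBlocks (1 : Matrix ι ι R) ((↑a⁻¹ : Matrix ι ι R) * b) 0
      (1 : Matrix κ κ R)) :=
    isUnit_iff_exists.2 ⟨Matrix.fromBlocks (1 : Matrix ι ι R) (-((↑a⁻¹ : Matrix ι ι R) * b)) 0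
      (1 : Matrix κ κ R), by rw [Matrix.fromBlocks_multiply]; simp,
      by rw [Matrix.fromBlocks_multiply]; simp⟩
  have h4 : Matrix.fromBlocks (a : Matrix ι ι R) b c d =
      Matrix.fromBlocks (1 : Matrix ι ι R) 0 (c * (↑a⁻¹ : Matrix ι ι R)) (1 : Matrix κ κ R) *
      Matrix.fromBlocks (a : Matrix ι ι R) 0 0 (s : Matrix κ κ R) *
      Matrix.fromBlocks (1 : Matrix ι ι R) ((↑a⁻¹ : Matrix ι ι R) * b) 0 1 := by
    rw [hs]
    simp [Matrix.fromBlocks_multiply, Matrix.mul_assoc, ← Matrix.mul_assoc (a : Matrix ι ι R)]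
  rw [h4]
  exact (h1.mul h2).mul h3

end Blocks

end Ring

section Matrix

variable {R S : Type*} [NormedRing R] [NormedRing S] {φ : R →+* S}

theorem DenseSpectral.exists_nhds_matrix [CompleteSpace S] (h : DenseSpectral φ) (n : ℕ) :
    ∃ U ∈ 𝓝 (1 : Matrix (Fin n) (Fin n) S), ∀ x : Matrix (Fin n) (Fin n) R,
      x.map φ ∈ U → IsUnit x := by
  induction n with
  | zero => exact ⟨univ, univ_mem, fun x _ => by rw [Subsingleton.elim x 1]; exact isUnit_one⟩
  | succ n ih =>
    obtain ⟨U, hU, h1⟩ := ih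
    obtain ⟨V, hV, h2⟩ := h.isUnit_of_near_one
    let e : Fin 1 ⊕ Fin n ≃ Fin (n + 1) := finSumFinEquiv.trans (finCongr (add_comm 1 n))
    let bl (m : Matrix (Fin (n + 1)) (Fin (n + 1)) S) := m.submatrix e e
    have hbl : Continuous bl := by fun_prop
    let inv (m : Matrix (Fin (n + 1)) (Fin (n + 1)) S) : Matrix (Fin 1) (Fin 1) S :=
      Matrix.of fun _ _ => Ring.inverse ((bl m).toBlocks₁₁ 0 0)
    let f (m : Matrix (Fin (n + 1)) (Fin (n + 1)) S) : Matrix (Fin n) (Fin n) S :=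
      (bl m).toBlocks₂₂ - (bl m).toBlocks₂₁ * inv m * (bl m).toBlocks₁₂
    have hone : bl 1 = Matrix.fromBlocks 1 0 0 1 := by
      simp [bl]
    have h11 : (bl 1).toBlocks₁₁ = 1 := by rw [hone, Matrix.toBlocks_fromBlocks₁₁]
    have h12 : (bl 1).toBlocks₁₂ = 0 := by rw [hone, Matrix.toBlocks_fromBlocks₁₂]
    have h22 : (bl 1).toBlocks₂₂ = 1 := by rw [hone, Matrix.toBlocks_fromBlocks₂₂]
    have hc1 : Continuous fun m => (bl m).toBlocks₁₁ := by
      simp only [bl, Matrix.toBlocks₁₁]; fun_prop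
    have hc2 : Continuous fun m => (bl m).toBlocks₂₂ := by
      simp only [bl, Matrix.toBlocks₂₂]; fun_prop
    have hc3 : Continuous fun m => (bl m).toBlocks₁₂ := by
      simp only [bl, Matrix.toBlocks₁₂]; fun_prop
    have hc4 : Continuous fun m => (bl m).toBlocks₂₁ := by
      simp only [bl, Matrix.toBlocks₂₁]; fun_prop
    have hc0 : Continuous fun m => (bl m).toBlocks₁₁ 0 0 := hc1.matrix_elem 0 0
    have hc5 : ContinuousAt inv 1 := by
      refine continuousAt_pi.2 fun _ => continuousAt_pi.2 fun _ => ?_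
      refine ContinuousAt.comp (g := Ring.inverse) (f := fun m => (bl m).toBlocks₁₁ 0 0) ?_
        hc0.continuousAt
      have : (bl 1).toBlocks₁₁ 0 0 = ((1 : Sˣ) : S) := by simp [h11]
      rw [this]
      exact NormedRing.inverse_continuousAt 1
    have hmul {p q r : ℕ} {a : Matrix (Fin (n + 1)) (Fin (n + 1)) S → Matrix (Fin p) (Fin q) S}
        {b : Matrix (Fin (n + 1)) (Fin (n + 1)) S → Matrix (Fin q) (Fin r) S}
        (ha : ContinuousAt a 1) (hb : ContinuousAt b 1) : ContinuousAt (fun m => a m * b m) 1 :=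
      (Continuous.matrix_mul continuous_fst continuous_snd).continuousAt.comp
        (f := fun m => (a m, b m)) (ha.prodMk hb)
    have hf : ContinuousAt f 1 :=
      hc2.continuousAt.sub (hmul (hmul hc4.continuousAt hc5) hc3.continuousAt)
    have hf1 : f 1 = 1 := by simp [f, h12, h22]
    refine ⟨{m | (bl m).toBlocks₁₁ 0 0 ∈ V ∧ f m ∈ U}, ?_, ?_⟩
    · refine Filter.inter_mem (hc0.continuousAt ?_) (hf ?_)
      · simpa [h11] using hV
      · rwa [hf1]
    · rintro x ⟨hx1, hx2⟩
      have hx3 : (x.submatrix e e).map φ = bl (x.map φ) := rfl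
      obtain ⟨u, hu⟩ := h2 (x (e (Sum.inl 0)) (e (Sum.inl 0))) hx1
      let a : (Matrix (Fin 1) (Fin 1) R)ˣ :=
        Units.map (Matrix.uniqueRingEquiv (m := Fin 1)).symm.toRingHom.toMonoidHom u
      have ha : (a : Matrix (Fin 1) (Fin 1) R) = (x.submatrix e e).toBlocks₁₁ := by
        ext i j
        rw [Subsingleton.elim i 0, Subsingleton.elim j 0]
        exact hu
      have hx4 : ((↑a⁻¹ : Matrix (Fin 1) (Fin 1) R)).map φ = inv (x.map φ) := by
        ext i j
        show φ (↑u⁻¹ : R) = Ring.inverse (φ (x (e (Sum.inl 0)) (e (Sum.inl 0))))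
        rw [← hu]
        exact (Ring.inverse_unit (Units.map φ.toMonoidHom u)).symm
      have hx5 : IsUnit (x.submatrix e e) := by
        rw [← Matrix.fromBlocks_toBlocks (x.submatrix e e), ← ha]
        refine isUnit_fromBlocks a _ _ _ (h1 _ ?_)
        convert hx2 using 1
        simp only [f, ← hx4, Matrix.map_sub φ (map_sub φ), Matrix.map_mul]
        rfl
      have hx6 := hx5.map (Matrix.reindexRingEquiv R e)
      simpa [Matrix.reindexRingEquiv] using hx6

theorem DenseSpectral.mapMatrix [CompleteSpace S] (h : DenseSpectral φ) (n : ℕ) :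
    DenseSpectral (φ.mapMatrix (m := Fin n)) where
  continuous := continuous_id.matrix_map h.continuous
  denseRange := denseRange_map_matrix h.denseRange
  isUnit_of_near_one := h.exists_nhds_matrix n

end Matrix

end BanachK

namespace BanachK

/-! ### Inverse square roots in Banach algebras -/

section InvSqrt

theorem choose_succ_mul_succ (a : ℂ) (n : ℕ) :
    Ring.choose a (n + 1) * (n + 1) = Ring.choose a n * (a - n) := by
  simp only [Ring.choose_eq_smul, smul_eq_mul, descPochhammer_succ_right, Polynomial.smeval_mul,
    Polynomial.smeval_sub, Polynomial.smeval_X, Polynomial.smeval_natCast, pow_one, pow_zero,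
    nsmul_eq_mul, mul_one, Nat.factorial_succ, Nat.cast_mul, Nat.cast_succ]
  have h1 : ((n : ℂ) + 1) ≠ 0 := Nat.cast_add_one_ne_zero n
  have h2 : ((n.factorial : ℕ) : ℂ) ≠ 0 := Nat.cast_ne_zero.2 n.factorial_ne_zero
  field_simp

/-- The coefficients of the power series of `(1 + t)^(-1/2)`. -/
noncomputable def invSqrtCoeff (n : ℕ) : ℂ := Ring.choose (-(1 / 2) : ℂ) n

theorem invSqrtCoeff_zero : invSqrtCoeff 0 = 1 := Ring.choose_zero_right _

theorem norm_invSqrtCoeff_le (n : ℕ) : ‖invSqrtCoeff n‖ ≤ 1 := by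
  induction n with
  | zero => simp [invSqrtCoeff_zero]
  | succ n ih =>
    have h1 := congrArg norm (choose_succ_mul_succ (-(1 / 2)) n)
    rw [norm_mul, norm_mul] at h1
    have h2 : ‖((n : ℂ) + 1)‖ = n + 1 := by
      rw [← Nat.cast_succ, Complex.norm_natCast, Nat.cast_succ]
    have h3 : ‖(-(1 / 2) : ℂ) - n‖ ≤ n + 1 := by
      refine (norm_sub_le _ _).trans ?_
      rw [Complex.norm_natCast, norm_neg]
      norm_num
      linarith
    rw [h2] at h1
    have h4 : ‖invSqrtCoeff (n + 1)‖ * (n + 1) ≤ 1 * (n + 1) := by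
      rw [invSqrtCoeff, h1]
      exact mul_le_mul ih h3 (norm_nonneg _) zero_le_one
    exact le_of_mul_le_mul_right h4 (by positivity)

theorem sum_invSqrtCoeff_mul (n : ℕ) :
    ∑ p ∈ Finset.HasAntidiagonal.antidiagonal n, invSqrtCoeff p.1 * invSqrtCoeff p.2 = (-1) ^ n := by
  set b : PowerSeries ℂ := PowerSeries.binomialSeries ℂ (-(1 / 2) : ℂ) with hb
  have h1 : b * b * (1 + PowerSeries.X) = 1 := by
    rw [hb, ← PowerSeries.binomialSeries_add, ← pow_one (1 + PowerSeries.X),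
      ← PowerSeries.binomialSeries_nat (R := ℂ), ← PowerSeries.binomialSeries_add]
    norm_num
  have h2 (n : ℕ) : PowerSeries.coeff n (b * b) = (-1) ^ n := by
    induction n with
    | zero =>
      have := congrArg (PowerSeries.coeff 0) h1
      simpa [mul_add] using this
    | succ n ih =>
      have := congrArg (PowerSeries.coeff (n + 1)) h1
      rw [mul_add, mul_one, map_add, PowerSeries.coeff_succ_mul_X, ih, PowerSeries.coeff_one,
        if_neg n.succ_ne_zero] at this
      rw [pow_succ]
      linear_combination this
  rw [← h2, PowerSeries.coeff_mul]
  simp [hb, PowerSeries.binomialSeries_coeff, invSqrtCoeff]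

variable {T : Type*} [NormedRing T] [NormedAlgebra ℂ T]

/-- The sum of the power series of `(1 + t)^(-1/2)`. -/
noncomputable def invSqrt (t : T) : T := ∑' n, invSqrtCoeff n • t ^ n

theorem norm_invSqrt_term_le (t : T) (n : ℕ) : ‖invSqrtCoeff n • t ^ n‖ ≤ ‖t ^ n‖ := by
  rw [norm_smul]
  exact mul_le_of_le_one_left (norm_nonneg _) (norm_invSqrtCoeff_le n)

theorem summable_invSqrt {t : T} (h : Summable fun n => ‖t ^ n‖) :
    Summable fun n => ‖invSqrtCoeff n • t ^ n‖ :=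
  h.of_nonneg_of_le (fun _ => norm_nonneg _) (norm_invSqrt_term_le t)

theorem commute_invSqrt {a t : T} (h : Commute a t) : Commute a (invSqrt t) :=
  Commute.tsum_right a fun n => (h.pow_right n).smul_right _

variable [CompleteSpace T]

theorem invSqrt_mul_self {t : T} (h : Summable fun n => ‖t ^ n‖) :
    invSqrt t * invSqrt t * (1 + t) = 1 := by
  have h1 : invSqrt t * invSqrt t = ∑' n, (-t) ^ n := by
    rw [invSqrt, tsum_mul_tsum_eq_tsum_sum_antidiagonal_of_summable_norm (summable_invSqrt h)
      (summable_invSqrt h)]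
    refine tsum_congr fun n => ?_
    have : (-t) ^ n = ((-1 : ℂ) ^ n) • t ^ n := by
      rw [neg_pow, Algebra.smul_def]; simp
    rw [this, ← sum_invSqrtCoeff_mul, Finset.sum_smul]
    refine Finset.sum_congr rfl fun p hp => ?_
    rw [smul_mul_smul_comm, ← pow_add, Finset.HasAntidiagonal.mem_antidiagonal.1 hp]
  have h2 : Summable fun n => (-t) ^ n := by
    refine Summable.of_norm (h.of_nonneg_of_le (fun _ => norm_nonneg _) fun n => ?_)
    rcases Nat.even_or_odd n with hn | hn
    · rw [hn.neg_pow]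
    · rw [hn.neg_pow, norm_neg]
  rw [h1, ← sub_neg_eq_add, h2.tsum_pow_mul_one_sub]

theorem norm_invSqrt_sub_one_le {t : T} (h : ‖t‖ ≤ 1 / 2) : ‖invSqrt t - 1‖ ≤ 2 * ‖t‖ := by
  have hlt : ‖t‖ < 1 := by linarith
  have h1 : invSqrt t - 1 = ∑' n, invSqrtCoeff (n + 1) • t ^ (n + 1) := by
    rw [invSqrt, (summable_invSqrt (summable_norm_geometric_of_norm_lt_one hlt)).of_norm.tsum_eq_zero_add,
      invSqrtCoeff_zero]
    simp
  have h2 : HasSum (fun n : ℕ => ‖t‖ * ‖t‖ ^ n) (‖t‖ * (1 - ‖t‖)⁻¹) :=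
    (hasSum_geometric_of_lt_one (norm_nonneg t) hlt).mul_left _
  rw [h1]
  refine (tsum_of_norm_bounded h2 fun n => ?_).trans ?_
  · refine (norm_invSqrt_term_le t _).trans ((norm_pow_le' t n.succ_pos).trans_eq ?_)
    rw [pow_succ']
  · rw [mul_comm]
    refine mul_le_mul_of_nonneg_right ?_ (norm_nonneg t)
    rw [inv_le_comm₀ (by linarith) two_pos]
    linarith

theorem map_invSqrt {T' : Type*} [NormedRing T'] [NormedAlgebra ℂ T'] (Φ : T →ₐ[ℂ] T')
    (hΦ : Continuous Φ) {t : T} (h : Summable fun n => ‖t ^ n‖) :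
    Φ (invSqrt t) = invSqrt (Φ t) := by
  rw [invSqrt, (summable_invSqrt h).of_norm.map_tsum Φ hΦ]
  simp [invSqrt]

/-- Functional calculus with the function that is `0` near `0` and `1` near `1`. -/
noncomputable def idemOf (a : T) : T :=
  (1 / 2 : ℂ) • (1 + (2 * a - 1) * invSqrt (4 * (a * a - a)))

theorem idemOf_mul_self {a : T} (h : Summable fun n => ‖(4 * (a * a - a)) ^ n‖) :
    idemOf a * idemOf a = idemOf a := by
  set t := 4 * (a * a - a) with ht
  set s := invSqrt t with hs
  have hc : Commute a t := by
    have h4 : Commute a 4 := (Nat.cast_commute 4 a).symm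
    exact h4.mul_right (((Commute.refl a).mul_right (Commute.refl a)).sub_right (Commute.refl a))
  have hc' : Commute (2 * a - 1) s := by
    have h2 : Commute (2 : T) s := Nat.cast_commute 2 s
    exact (h2.mul_left (commute_invSqrt hc)).sub_left (Commute.one_left s)
  have hc'' : Commute (1 + t) s := (Commute.one_left s).add_left (commute_invSqrt (Commute.refl t))
  have hp : (2 * a - 1) * (2 * a - 1) = 1 + t := by
    rw [ht]; noncomm_ring
  have hq : ((2 * a - 1) * s) * ((2 * a - 1) * s) = 1 := by
    calc ((2 * a - 1) * s) * ((2 * a - 1) * s) = (2 * a - 1) * (s * (2 * a - 1)) * s := by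
          noncomm_ring
      _ = (2 * a - 1) * ((2 * a - 1) * s) * s := by rw [hc'.eq]
      _ = ((2 * a - 1) * (2 * a - 1)) * (s * s) := by simp only [mul_assoc]
      _ = (1 + t) * (s * s) := by rw [hp]
      _ = s * s * (1 + t) := (hc''.mul_right hc'').eq
      _ = 1 := invSqrt_mul_self h
  rw [idemOf, ← ht, ← hs, smul_mul_smul_comm, add_mul, one_mul, mul_add, mul_one, hq]
  rw [show (1 + (2 * a - 1) * s + ((2 * a - 1) * s + 1)) = (2 : ℂ) • (1 + (2 * a - 1) * s) by
    rw [two_smul]; abel, smul_smul]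
  norm_num

theorem map_idemOf {T' : Type*} [NormedRing T'] [NormedAlgebra ℂ T'] (Φ : T →ₐ[ℂ] T')
    (hΦ : Continuous Φ) {a : T} (h : Summable fun n => ‖(4 * (a * a - a)) ^ n‖) :
    Φ (idemOf a) = idemOf (Φ a) := by
  simp [idemOf, map_invSqrt Φ hΦ h, map_ofNat]

theorem tendsto_idemOf {e : T} (he : e * e = e) : Tendsto idemOf (𝓝 e) (𝓝 e) := by
  have h0 : Tendsto (fun a : T => 4 * (a * a - a)) (𝓝 e) (𝓝 0) := by
    have : Continuous fun a : T => 4 * (a * a - a) := by fun_prop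
    simpa [he] using this.tendsto e
  have h1 : Tendsto (invSqrt : T → T) (𝓝 0) (𝓝 1) := by
    rw [tendsto_iff_norm_sub_tendsto_zero]
    refine squeeze_zero' (Eventually.of_forall fun _ => norm_nonneg _)
      (g := fun t : T => 2 * ‖t‖) ?_ ?_
    · filter_upwards [Metric.closedBall_mem_nhds (0 : T) (half_pos one_pos)] with t ht
      exact norm_invSqrt_sub_one_le (by simpa using ht)
    · have : Continuous fun t : T => 2 * ‖t‖ := by fun_prop
      simpa using this.tendsto 0
  have h2 : Tendsto (fun a : T => 2 * a - 1) (𝓝 e) (𝓝 (2 * e - 1)) := by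
    have : Continuous fun a : T => 2 * a - 1 := by fun_prop
    exact this.tendsto e
  have h3 := (tendsto_const_nhds (x := (1 : T)).add (h2.mul (h1.comp h0))).const_smul (1 / 2 : ℂ)
  have h4 : (1 / 2 : ℂ) • (1 + (2 * e - 1) * 1) = e := by
    rw [mul_one, add_sub_cancel, ← two_smul ℂ e |>.trans (two_mul e).symm, smul_smul]
    norm_num
  rw [h4] at h3
  exact h3

end InvSqrt

/-! ### Path components of unit groups -/

section Units

variable {T : Type*} [NormedRing T] [NormedAlgebra ℂ T] [CompleteSpace T]

theorem mem_pathComponentOne_of_segment (u : Tˣ)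
    (h : ∀ s : ℝ, 0 ≤ s → s ≤ 1 → IsUnit (1 + (s : ℂ) • ((u : T) - 1))) :
    u ∈ Subgroup.pathComponentOne Tˣ := by
  let f (s : unitInterval) : Tˣ := (h s s.2.1 s.2.2).unit
  have hf : Continuous f := Units.isOpenEmbedding_val.isInducing.continuous_iff.2 (by
    show Continuous fun s : unitInterval => 1 + ((s : ℝ) : ℂ) • ((u : T) - 1)
    fun_prop)
  refine ⟨⟨⟨f, hf⟩, Units.ext ?_, Units.ext ?_⟩⟩
  · show 1 + (((0 : unitInterval) : ℝ) : ℂ) • ((u : T) - 1) = 1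
    simp
  · show 1 + (((1 : unitInterval) : ℝ) : ℂ) • ((u : T) - 1) = u
    simp

variable {T' : Type*} [NormedRing T'] [NormedAlgebra ℂ T'] {Φ : T →ₐ[ℂ] T'}

theorem mem_pathComponentOne_of_near {ε : ℝ}
    (hε : ∀ x, Φ x ∈ Metric.ball (1 : T') ε → IsUnit x) (u : Tˣ)
    (hu : Φ u ∈ Metric.ball (1 : T') ε) : u ∈ Subgroup.pathComponentOne Tˣ := by
  refine mem_pathComponentOne_of_segment u fun s h0 h1 => hε _ ?_
  rw [mem_ball_iff_norm] at hu ⊢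
  rw [map_add, map_smul, map_sub, map_one, add_sub_cancel_left, norm_smul, Complex.norm_real,
    Real.norm_of_nonneg h0]
  exact (mul_le_of_le_one_left (norm_nonneg _) h1).trans_lt hu

theorem mem_pathComponentOne_of_near_one (u : Tˣ) (hu : (u : T) ∈ Metric.ball (1 : T) 1) :
    u ∈ Subgroup.pathComponentOne Tˣ :=
  mem_pathComponentOne_of_near (Φ := AlgHom.id ℂ T) (fun x hx => by
    have : ‖1 - x‖ < 1 := by rwa [mem_ball_iff_norm'] at hx
    simpa using isUnit_one_sub_of_norm_lt_one this) u hu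

/-- A dense spectral homomorphism of Banach algebras induces a bijection between the groups of path
components of the unit groups. -/
theorem DenseSpectral.bijective_pathMap [CompleteSpace T'] (h : DenseSpectral Φ.toRingHom)
    (hc : Continuous (Units.map Φ.toRingHom.toMonoidHom)) :
    Function.Bijective (pathMap (Units.map Φ.toRingHom.toMonoidHom) hc) := by
  obtain ⟨U, hU, h1⟩ := h.isUnit_of_near_one
  obtain ⟨ε, hε, hεU⟩ := Metric.mem_nhds_iff.1 hU
  have hN (x : T) (hx : Φ x ∈ Metric.ball (1 : T') ε) : IsUnit x := h1 x (hεU hx)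
  constructor
  · rw [injective_iff_map_eq_one]
    intro x
    induction x using QuotientGroup.induction_on with | _ v => ?_
    intro hv
    have hv' : Units.map Φ.toRingHom.toMonoidHom v ∈ Subgroup.pathComponentOne T'ˣ :=
      (QuotientGroup.eq_one_iff _).1 hv
    refine (QuotientGroup.eq_one_iff _).2 ?_
    set H := ((Subgroup.pathComponentOne Tˣ).map
      (Units.map Φ.toRingHom.toMonoidHom)).topologicalClosure with hH
    have hopen : IsOpen (H : Set T'ˣ) := by
      refine H.isOpen_of_mem_nhds (g := 1) ?_
      have hb : (Units.val : T'ˣ → T') ⁻¹' Metric.ball 1 ε ∈ 𝓝 (1 : T'ˣ) :=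
        Units.continuous_val.continuousAt (Metric.ball_mem_nhds _ hε)
      refine Filter.mem_of_superset hb fun u hu => mem_closure_iff_nhds.2 fun W hW => ?_
      have hW' : (Units.val : T'ˣ → T') '' W ∈ 𝓝 (u : T') :=
        Units.isOpenEmbedding_val.isOpenMap.image_mem_nhds hW
      obtain ⟨_, ⟨⟨w, hw, h2⟩, h3⟩, t, rfl⟩ := mem_closure_iff_nhds.1 (h.denseRange (u : T')) _
        (Filter.inter_mem hW' (Metric.isOpen_ball.mem_nhds hu))
      obtain ⟨v, rfl⟩ := hN t h3
      refine ⟨w, hw, v, mem_pathComponentOne_of_near hN v h3, Units.ext h2.symm⟩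
    have hclopen : IsClopen (H : Set T'ˣ) := ⟨H.isClosed_of_isOpen hopen, hopen⟩
    have hvH : Units.map Φ.toRingHom.toMonoidHom v ∈ H :=
      hclopen.connectedComponent_subset H.one_mem (pathComponent_subset_component _ hv')
    have hnb : {u : T'ˣ | (↑(u⁻¹ * Units.map Φ.toRingHom.toMonoidHom v) : T') ∈ Metric.ball 1 ε} ∈
        𝓝 (Units.map Φ.toRingHom.toMonoidHom v) := by
      have : Continuous fun u : T'ˣ => (↑(u⁻¹ * Units.map Φ.toRingHom.toMonoidHom v) : T') :=
        Units.continuous_val.comp (by fun_prop)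
      refine this.continuousAt (Metric.isOpen_ball.mem_nhds ?_)
      simpa using hε
    obtain ⟨_, h2, w, hw, rfl⟩ := mem_closure_iff_nhds.1 hvH _ hnb
    have h3 : w⁻¹ * v ∈ Subgroup.pathComponentOne Tˣ := by
      refine mem_pathComponentOne_of_near hN _ ?_
      have h4 : (Units.map Φ.toRingHom.toMonoidHom w)⁻¹ * Units.map Φ.toRingHom.toMonoidHom v =
        Units.map Φ.toRingHom.toMonoidHom (w⁻¹ * v) := by rw [map_mul, map_inv]
      have h5 : (((Units.map Φ.toRingHom.toMonoidHom w)⁻¹ *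
        Units.map Φ.toRingHom.toMonoidHom v : T'ˣ) : T') ∈ Metric.ball 1 ε := h2
      rwa [h4] at h5
    simpa using mul_mem hw h3
  · intro x
    induction x using QuotientGroup.induction_on with | _ u => ?_
    have hnb : ∀ᶠ b in 𝓝 (u : T'), (↑u⁻¹ : T') * b ∈ Metric.ball (1 : T') 1 := by
      have : Continuous fun b : T' => (↑u⁻¹ : T') * b := by fun_prop
      refine this.continuousAt (Metric.isOpen_ball.mem_nhds ?_)
      simp
    obtain ⟨_, ⟨h2, w, h3⟩, t, rfl⟩ := mem_closure_iff_nhds.1 (h.denseRange (u : T')) _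
      (hnb.and (Units.nhds u))
    obtain ⟨v, rfl⟩ := h.isUnit_of_map ⟨w, h3⟩
    refine ⟨QuotientGroup.mk v, Eq.symm ?_⟩
    refine QuotientGroup.eq.2 (mem_pathComponentOne_of_near_one _ ?_)
    exact h2

end Units

/-! ### Lifting idempotents -/

section Idempotents

variable {T T' : Type*} [NormedRing T] [NormedAlgebra ℂ T] [CompleteSpace T] [NormedRing T']
  [NormedAlgebra ℂ T'] [CompleteSpace T'] {Φ : T →ₐ[ℂ] T'}

theorem DenseSpectral.exists_summable_pow (h : DenseSpectral Φ.toRingHom) :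
    ∀ᶠ s in 𝓝 (0 : T'), ∀ x, Φ x = s → Summable fun n => ‖x ^ n‖ := by
  obtain ⟨U, hU, h1⟩ := h.isUnit_of_near_one
  obtain ⟨ε, hε, hεU⟩ := Metric.mem_nhds_iff.1 hU
  filter_upwards [Metric.ball_mem_nhds (0 : T') (half_pos hε)]
  rintro _ hs x rfl
  rw [mem_ball_zero_iff] at hs
  have hspec (z : ℂ) (hz : z ∈ spectrum ℂ x) : ‖z‖ ≤ 1 / 2 := by
    by_contra! hlt
    refine spectrum.mem_iff.1 hz ?_
    have hz0 : z ≠ 0 := by rintro rfl; norm_num at hlt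
    have hu : IsUnit (1 - z⁻¹ • x) := by
      refine h1 _ (hεU ?_)
      rw [mem_ball_iff_norm']
      show ‖1 - Φ (1 - z⁻¹ • x)‖ < ε
      rw [map_sub, map_one, map_smul, sub_sub_cancel, norm_smul, norm_inv]
      calc ‖z‖⁻¹ * ‖Φ x‖ ≤ 2 * ‖Φ x‖ := by
            refine mul_le_mul_of_nonneg_right ?_ (norm_nonneg _)
            rw [inv_le_comm₀ (by linarith) two_pos]
            linarith
        _ < ε := by linarith
    have h2 : algebraMap ℂ T z - x = algebraMap ℂ T z * (1 - z⁻¹ • x) := by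
      rw [← Algebra.smul_def, smul_sub, smul_smul, mul_inv_cancel₀ hz0, one_smul,
        Algebra.algebraMap_eq_smul_one]
    rw [h2]
    exact ((IsUnit.mk0 z hz0).map _).mul hu
  have hrad : spectralRadius ℂ x ≤ ((1 / 2 : NNReal) : ℝ≥0∞) := iSup₂_le fun z hz => by
    exact_mod_cast hspec z hz
  have hlt : spectralRadius ℂ x < ((3 / 4 : NNReal) : ℝ≥0∞) :=
    hrad.trans_lt (ENNReal.coe_lt_coe.2 (by
      rw [← NNReal.coe_lt_coe]; push_cast; norm_num))
  have hev := (spectrum.pow_nnnorm_pow_one_div_tendsto_nhds_spectralRadius x).eventually_lt_const hlt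
  refine Summable.of_norm_bounded_eventually_nat (g := fun n => (3 / 4 : ℝ) ^ n)
    (summable_geometric_of_lt_one (by norm_num) (by norm_num)) ?_
  filter_upwards [hev, eventually_gt_atTop 0] with n hn hn0
  rw [norm_norm]
  rw [← ENNReal.coe_rpow_of_nonneg _ (by positivity), ENNReal.coe_lt_coe] at hn
  have h3 : ((‖x ^ n‖₊ ^ (1 / (n : ℝ)) : NNReal)) ^ n ≤ (3 / 4 : NNReal) ^ n :=
    pow_le_pow_left₀ zero_le hn.le n
  rw [← NNReal.rpow_natCast, ← NNReal.rpow_mul, one_div,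
    inv_mul_cancel₀ (Nat.cast_ne_zero.2 hn0.ne'), NNReal.rpow_one, ← NNReal.coe_le_coe] at h3
  push_cast at h3
  exact h3

theorem DenseSpectral.exists_idempotent (h : DenseSpectral Φ.toRingHom) {e : T'} (he : e * e = e)
    {W : Set T'} (hW : W ∈ 𝓝 e) : ∃ f : T, f * f = f ∧ Φ f ∈ W := by
  have h0 : Tendsto (fun a : T' => 4 * (a * a - a)) (𝓝 e) (𝓝 0) := by
    have : Continuous fun a : T' => 4 * (a * a - a) := by fun_prop
    simpa [he] using this.tendsto e
  obtain ⟨_, ⟨h1, h2⟩, a, rfl⟩ := mem_closure_iff_nhds.1 (h.denseRange e) _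
    ((h0.eventually h.exists_summable_pow).and (tendsto_idemOf he hW))
  have h3 := h1 (4 * (a * a - a)) (by
    show Φ _ = 4 * (Φ a * Φ a - Φ a)
    simp [map_ofNat])
  refine ⟨idemOf a, idemOf_mul_self h3, ?_⟩
  rw [map_idemOf Φ h.continuous h3]
  exact h2

end Idempotents

end BanachK

namespace BanachK

/-! ### Dense spectral homomorphisms induce isomorphisms in K-theory -/

section MvN

variable {R : Type*} [Ring R] {ι κ : Type} [Fintype ι] [Fintype κ] [DecidableEq ι] [DecidableEq κ]

theorem MvN.of_isUnit {e : Matrix ι ι R} {f : Matrix κ κ R} (he : e * e = e) (hf : f * f = f)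
    (x : Matrix ι κ R) (y : Matrix κ ι R) (hx : IsUnit (e * x * f * y * e + (1 - e)))
    (hy : IsUnit (f * y * e * x * f + (1 - f))) : MvN e f := by
  obtain ⟨x', hx'⟩ : ∃ x', x' = e * x * f := ⟨_, rfl⟩
  obtain ⟨y', hy'⟩ : ∃ y', y' = f * y * e := ⟨_, rfl⟩
  have hex : e * x' = x' := by simp only [hx', ← Matrix.mul_assoc, he]
  have hxf : x' * f = x' := by simp only [hx', Matrix.mul_assoc, hf]
  have hfy : f * y' = y' := by simp only [hy', ← Matrix.mul_assoc, hf]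
  have hye : y' * e = y' := by simp only [hy', Matrix.mul_assoc, he]
  have hxy : e * x * f * y * e = x' * y' := by
    rw [hx', hy']
    simp only [Matrix.mul_assoc]
    rw [← Matrix.mul_assoc f f, hf]
  have hyx : f * y * e * x * f = y' * x' := by
    rw [hx', hy']
    simp only [Matrix.mul_assoc]
    rw [← Matrix.mul_assoc e e, he]
  rw [hxy] at hx
  rw [hyx] at hy
  obtain ⟨u, hu⟩ := hx
  obtain ⟨w, hw⟩ := hy
  have heu : e * (u : Matrix ι ι R) = x' * y' := by
    rw [hu, mul_add, mul_sub, mul_one, he, sub_self, add_zero, ← Matrix.mul_assoc, hex]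
  have hue : (u : Matrix ι ι R) * e = x' * y' := by
    rw [hu, add_mul, sub_mul, one_mul, he, sub_self, add_zero, Matrix.mul_assoc, hye]
  have hfw : f * (w : Matrix κ κ R) = y' * x' := by
    rw [hw, mul_add, mul_sub, mul_one, hf, sub_self, add_zero, ← Matrix.mul_assoc, hfy]
  have hue' : (↑u⁻¹ : Matrix ι ι R) * (x' * y') = e := by
    rw [← hue, ← mul_assoc, Units.inv_mul, one_mul]
  have heu' : x' * y' * (↑u⁻¹ : Matrix ι ι R) = e := by
    rw [← heu, mul_assoc, Units.mul_inv, mul_one]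
  refine ⟨x', y' * (↑u⁻¹ : Matrix ι ι R), by rw [← Matrix.mul_assoc, heu'], ?_⟩
  have h1 : y' * (↑u⁻¹ : Matrix ι ι R) * x' * (w : Matrix κ κ R) = f * (w : Matrix κ κ R) := by
    have h2 : x' * (w : Matrix κ κ R) = x' * y' * x' := by
      rw [← hxf, Matrix.mul_assoc x' f, hfw, hxf, Matrix.mul_assoc]
    rw [Matrix.mul_assoc, h2, hfw, Matrix.mul_assoc, ← Matrix.mul_assoc _ (x' * y'), hue', hex]
  calc y' * (↑u⁻¹ : Matrix ι ι R) * x'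
      = y' * (↑u⁻¹ : Matrix ι ι R) * x' * (w : Matrix κ κ R) * (↑w⁻¹ : Matrix κ κ R) := by
        rw [Matrix.mul_assoc _ (w : Matrix κ κ R), Units.mul_inv, Matrix.mul_one]
    _ = f := by rw [h1, Matrix.mul_assoc, Units.mul_inv, Matrix.mul_one]

end MvN

section V

variable {R S : Type*} [NormedRing R] [NormedAlgebra ℂ R] [CompleteSpace R]
  [NormedRing S] [NormedAlgebra ℂ S] [CompleteSpace S] {φ : R →ₐ[ℂ] S}

section

attribute [local instance] Matrix.linftyOpNormedRing Matrix.linftyOpNormedAlgebra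

theorem completeSpace_matrix {S : Type*} [NormedRing S] [CompleteSpace S] (n : ℕ) :
    @CompleteSpace (Matrix (Fin n) (Fin n) S) (Matrix.linftyOpNormedRing :
      NormedRing (Matrix (Fin n) (Fin n) S)).toMetricSpace.toUniformSpace :=
  inferInstanceAs (CompleteSpace (Fin n → Fin n → S))

theorem DenseSpectral.exists_idempotent_matrix (h : DenseSpectral φ.toRingHom) {n : ℕ}
    {e : Matrix (Fin n) (Fin n) S} (he : e * e = e) {W : Set (Matrix (Fin n) (Fin n) S)}
    (hW : W ∈ 𝓝 e) : ∃ f : Matrix (Fin n) (Fin n) R, f * f = f ∧ f.map φ ∈ W := by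
  have := completeSpace_matrix (S := R) n
  have := completeSpace_matrix (S := S) n
  exact DenseSpectral.exists_idempotent (Φ := φ.mapMatrix (m := Fin n)) (h.mapMatrix n) he hW

theorem isUnit_nhds_matrix (n : ℕ) : {x : Matrix (Fin n) (Fin n) S | IsUnit x} ∈ 𝓝 1 := by
  have := completeSpace_matrix (S := S) n
  exact Units.nhds (1 : (Matrix (Fin n) (Fin n) S)ˣ)

theorem DenseSpectral.bijective_GLPath (h : DenseSpectral φ.toRingHom) (n : ℕ) :
    Function.Bijective (GLPath.map φ.toRingHom h.continuous n) := by
  have := completeSpace_matrix (S := R) n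
  have := completeSpace_matrix (S := S) n
  exact DenseSpectral.bijective_pathMap (Φ := φ.mapMatrix (m := Fin n)) (h.mapMatrix n)
    (Continuous.units_map _ (continuous_id.matrix_map h.continuous))

end

theorem DenseSpectral.injective_V (h : DenseSpectral φ.toRingHom) :
    Function.Injective (V.map φ.toRingHom) := by
  intro a b
  induction a using Quotient.inductionOn with | _ e => ?_
  induction b using Quotient.inductionOn with | _ f => ?_
  intro hab
  obtain ⟨n, e, he⟩ := e
  obtain ⟨m, f, hf⟩ := f
  obtain ⟨x, y, hxy, hyx⟩ : MvN (e.map φ) (f.map φ) := Quotient.exact hab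
  obtain ⟨U, hU, hU'⟩ := h.exists_nhds_matrix n
  obtain ⟨W, hW, hW'⟩ := h.exists_nhds_matrix m
  set e' := e.map φ with he'
  set f' := f.map φ with hf'
  have hee : e' * e' = e' := mapIdem (f := φ.toRingHom) he
  have hff : f' * f' = f' := mapIdem (f := φ.toRingHom) hf
  have hex : e' * x = x * f' := by rw [← hxy, ← hyx, Matrix.mul_assoc]
  have hfy : f' * y = y * e' := by rw [← hxy, ← hyx, Matrix.mul_assoc]
  have h1 : Continuous fun q : Matrix (Fin n) (Fin m) S × Matrix (Fin m) (Fin n) S =>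
      e' * q.1 * f' * q.2 * e' + (1 - e') := by fun_prop
  have h2 : Continuous fun q : Matrix (Fin n) (Fin m) S × Matrix (Fin m) (Fin n) S =>
      f' * q.2 * e' * q.1 * f' + (1 - f') := by fun_prop
  have h3 : e' * x * f' * y * e' + (1 - e') = 1 := by
    have : e' * x * f' * y * e' = e' := by
      rw [Matrix.mul_assoc _ f' y, hfy, Matrix.mul_assoc, Matrix.mul_assoc, Matrix.mul_assoc, hee,
        ← Matrix.mul_assoc x, hxy, hee, hee]
    rw [this, add_sub_cancel]
  have h4 : f' * y * e' * x * f' + (1 - f') = 1 := by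
    have : f' * y * e' * x * f' = f' := by
      rw [Matrix.mul_assoc _ e' x, hex, Matrix.mul_assoc, Matrix.mul_assoc, Matrix.mul_assoc, hff,
        ← Matrix.mul_assoc y, hyx, hff, hff]
    rw [this, add_sub_cancel]
  obtain ⟨_, ⟨h5, h6⟩, ⟨x', y'⟩, rfl⟩ := mem_closure_iff_nhds.1
    ((denseRange_map_matrix h.denseRange).prodMap (denseRange_map_matrix h.denseRange) (x, y)) _
    (Filter.inter_mem (h1.continuousAt (x := (x, y)) (by simpa only [h3] using hU))
      (h2.continuousAt (x := (x, y)) (by simpa only [h4] using hW)))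
  have hmap {k : ℕ} (a b : Matrix (Fin k) (Fin k) R) : (a + (1 - b)).map φ.toRingHom =
      a.map φ.toRingHom + (1 - b.map φ.toRingHom) := by
    rw [Matrix.map_add _ (map_add _), Matrix.map_sub _ (map_sub _),
      Matrix.map_one _ (map_zero _) (map_one _)]
  refine Quotient.sound (show MvN e f from MvN.of_isUnit he hf x' y' (hU' _ ?_) (hW' _ ?_))
  · rw [hmap (e * x' * f * y' * e) e]
    simp only [Matrix.map_mul]
    exact h5
  · rw [hmap (f * y' * e * x' * f) f]
    simp only [Matrix.map_mul]
    exact h6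

theorem DenseSpectral.surjective_V (h : DenseSpectral φ.toRingHom) :
    Function.Surjective (V.map φ.toRingHom) := by
  intro a
  induction a using Quotient.inductionOn with | _ e => ?_
  obtain ⟨n, e, he⟩ := e
  have h1 : Continuous fun f : Matrix (Fin n) (Fin n) S => e * 1 * f * 1 * e + (1 - e) := by
    fun_prop
  have h2 : Continuous fun f : Matrix (Fin n) (Fin n) S => f * 1 * e * 1 * f + (1 - f) := by
    fun_prop
  have hW : {f | IsUnit (e * 1 * f * 1 * e + (1 - e))} ∩
      {f | IsUnit (f * 1 * e * 1 * f + (1 - f))} ∈ 𝓝 e :=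
    Filter.inter_mem
      (h1.continuousAt (x := e) (by simpa [he] using isUnit_nhds_matrix (S := S) n))
      (h2.continuousAt (x := e) (by simpa [he] using isUnit_nhds_matrix (S := S) n))
  obtain ⟨f, hf, h3, h4⟩ := h.exists_idempotent_matrix he hW
  exact ⟨(⟦⟨n, f, hf⟩⟧ : Quotient (idemSetoid R)),
    Quotient.sound (show MvN (f.map φ.toRingHom) e from
      MvN.of_isUnit (mapIdem (f := φ.toRingHom) hf) he 1 1 h4 h3)⟩

end V

section K

theorem K0Unital.bijective_map {R S : Type*} [Ring R] [Ring S] {f : R →+* S}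
    (h : Function.Bijective (V.map f)) : Function.Bijective (K0Unital.map f) := by
  let g : V S →+ V R := (AddEquiv.ofBijective (V.map f) h).symm.toAddMonoidHom
  let k : K0Unital S →+ K0Unital R :=
    Algebra.GrothendieckAddGroup.lift (Algebra.GrothendieckAddGroup.of.comp g)
  have hk (a : V S) : k (Algebra.GrothendieckAddGroup.of a) =
      Algebra.GrothendieckAddGroup.of (g a) :=
    DFunLike.congr_fun (Algebra.GrothendieckAddGroup.lift.symm_apply_apply
      (Algebra.GrothendieckAddGroup.of.comp g)) a
  refine Function.bijective_iff_has_inverse.2 ⟨k, fun x => ?_, fun x => ?_⟩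
  · suffices hid : k.comp (K0Unital.map f) = AddMonoidHom.id _ from DFunLike.congr_fun hid x
    apply Algebra.GrothendieckAddGroup.lift.symm.injective
    ext a
    show k (K0Unital.map f (Algebra.GrothendieckAddGroup.of a)) = Algebra.GrothendieckAddGroup.of a
    rw [K0Unital.map_of, hk]
    exact congrArg _ ((AddEquiv.ofBijective (V.map f) h).symm_apply_apply a)
  · suffices hid : (K0Unital.map f).comp k = AddMonoidHom.id _ from DFunLike.congr_fun hid x
    apply Algebra.GrothendieckAddGroup.lift.symm.injective
    ext a
    show K0Unital.map f (k (Algebra.GrothendieckAddGroup.of a)) = Algebra.GrothendieckAddGroup.of a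
    rw [hk, K0Unital.map_of]
    exact congrArg _ ((AddEquiv.ofBijective (V.map f) h).apply_symm_apply a)

theorem K1Unital.bijective_map {R S : Type*} [Ring R] [Ring S] [TopologicalSpace R]
    [IsTopologicalRing R] [TopologicalSpace S] [IsTopologicalRing S] {f : R →+* S}
    (hf : Continuous f) (h : ∀ n, Function.Bijective (GLPath.map f hf n)) :
    Function.Bijective (K1Unital.map f hf) := by
  constructor
  · intro x y
    induction x, y using DirectLimit.induction₂ with | _ n x y => ?_
    intro hxy
    obtain ⟨k, h1, h2, h3⟩ := Quotient.exact (hxy : (⟦⟨n, GLPath.map f hf n x⟩⟧ : K1Unital S) =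
      ⟦⟨n, GLPath.map f hf n y⟩⟧)
    refine Quotient.sound ⟨k, h1, h2, (h k).1 ?_⟩
    show GLPath.map f hf k (stab n k h1 x) = GLPath.map f hf k (stab n k h2 y)
    rw [← GLPath.map_stab, ← GLPath.map_stab]
    exact h3
  · intro y
    induction y using DirectLimit.induction with | _ n y => ?_
    obtain ⟨x, rfl⟩ := (h n).2 y
    exact ⟨(⟦⟨n, x⟩⟧ : K1Unital R), rfl⟩

variable {A B : Type*} [NonUnitalNormedRing A] [NormedSpace ℂ A] [IsScalarTower ℂ A A]
  [SMulCommClass ℂ A A] [NonUnitalNormedRing B] [NormedSpace ℂ B] [IsScalarTower ℂ B B]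
  [SMulCommClass ℂ B B]

/-- The unital extension `φ⁺` as a homomorphism of complex algebras. -/
noncomputable def plusAlgHom (φ : A →ₙₐ[ℂ] B) : Plus A →ₐ[ℂ] Plus B :=
  (WithLp.unitizationAlgEquiv (𝕜 := ℂ) (A := B) ℂ).symm.toAlgHom.comp
    ((Unitization.lift ((Unitization.inrNonUnitalAlgHom ℂ B).comp φ)).comp
      (WithLp.unitizationAlgEquiv (𝕜 := ℂ) (A := A) ℂ).toAlgHom)

variable [CompleteSpace A] [CompleteSpace B]

theorem K0.bijective_map (φ : A →ₙₐ[ℂ] B) (h : DenseSpectral (plusMap φ)) :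
    Function.Bijective (K0.map φ) := by
  have hV : Function.Bijective (V.map (plusMap φ)) :=
    ⟨DenseSpectral.injective_V (φ := plusAlgHom φ) h,
      DenseSpectral.surjective_V (φ := plusAlgHom φ) h⟩
  have hb := K0Unital.bijective_map hV
  constructor
  · intro x y hxy
    exact Subtype.ext (hb.1 (congrArg Subtype.val hxy))
  · intro y
    obtain ⟨x, hx⟩ := hb.2 y.1
    have hx0 : K0Unital.map (scalarPart A) x = 0 := by
      rw [← scalarPart_comp_plusMap φ, ← K0Unital.map_comp, hx]
      exact y.2
    exact ⟨⟨x, hx0⟩, Subtype.ext hx⟩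

theorem K1.bijective_map (φ : A →ₙₐ[ℂ] B) (hφ : Continuous φ) (h : DenseSpectral (plusMap φ)) :
    Function.Bijective (K1.map φ hφ) := by
  have hb := K1Unital.bijective_map (continuous_plusMap φ hφ)
    (DenseSpectral.bijective_GLPath (φ := plusAlgHom φ) h)
  constructor
  · intro x y hxy
    exact Subtype.ext (hb.1 (congrArg Subtype.val hxy))
  · intro y
    obtain ⟨x, hx⟩ := hb.2 y.1
    have hx0 : K1Unital.map (scalarPart A) (continuous_scalarPart A) x = 1 := by
      have h1 := K1Unital.map_comp (scalarPart B) (continuous_scalarPart B) (plusMap φ)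
        (continuous_plusMap φ hφ) x
      simp only [scalarPart_comp_plusMap] at h1
      rw [← h1, hx]
      exact y.2
    exact ⟨⟨x, hx0⟩, Subtype.ext hx⟩

end K

/-! ### A criterion for spectral homomorphisms -/

section Criterion

variable {A B : Type*} [NonUnitalNormedRing A] [NormedSpace ℂ A] [IsScalarTower ℂ A A]
  [SMulCommClass ℂ A A] [NonUnitalNormedRing B] [NormedSpace ℂ B] [IsScalarTower ℂ B B]
  [SMulCommClass ℂ B B]

/-- The inclusion of a Banach algebra in its unitisation. -/
noncomputable def toPlus (a : A) : Plus A := WithLp.toLp 1 (a : Unitization ℂ A)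

theorem norm_toPlus (a : A) : ‖toPlus a‖ = ‖a‖ := WithLp.unitization_norm_inr a

theorem toPlus_mul (a b : A) : toPlus (a * b) = toPlus a * toPlus b :=
  congrArg (WithLp.toLp 1) (Unitization.inr_mul ℂ a b)

theorem toPlus_sub (a b : A) : toPlus (a - b) = toPlus a - toPlus b :=
  congrArg (WithLp.toLp 1) (Unitization.inr_sub ℂ a b)

theorem toPlus_smul (c : ℂ) (a : A) : toPlus (c • a) = c • toPlus a :=
  congrArg (WithLp.toLp 1) (Unitization.inr_smul ℂ c a)

theorem plus_eq (x : Plus A) :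
    x = algebraMap ℂ (Plus A) (scalarPart A x) + toPlus (WithLp.ofLp x).snd :=
  congrArg (WithLp.toLp 1) (Unitization.inl_fst_add_inr_snd_eq (WithLp.ofLp x)).symm

theorem norm_plus (x : Plus A) : ‖x‖ = ‖scalarPart A x‖ + ‖(WithLp.ofLp x).snd‖ :=
  WithLp.unitization_norm_def x

theorem norm_plusMap (φ : A →ₙₐ[ℂ] B) (x : Plus A) :
    ‖plusMap φ x‖ = ‖scalarPart A x‖ + ‖φ (WithLp.ofLp x).snd‖ := by
  have h1 : scalarPart B (plusMap φ x) = scalarPart A x :=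
    DFunLike.congr_fun (scalarPart_comp_plusMap φ) x
  have h2 : (WithLp.ofLp (plusMap φ x)).snd = φ (WithLp.ofLp x).snd := by
    rw [plusMap_apply]
    exact zero_add _
  rw [norm_plus, h1, h2]

theorem plusMap_toPlus (φ : A →ₙₐ[ℂ] B) (a : A) : plusMap φ (toPlus a) = toPlus (φ a) := by
  rw [plusMap_apply]
  have : scalarPart A (toPlus a) = 0 := rfl
  rw [this, map_zero, zero_add]
  rfl

theorem denseRange_plusMap {φ : A →ₙₐ[ℂ] B} (hφ : DenseRange φ) : DenseRange (plusMap φ) := by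
  refine Metric.denseRange_iff.2 fun x ε hε => ?_
  obtain ⟨a, ha⟩ := hφ.exists_dist_lt (WithLp.ofLp x).snd hε
  refine ⟨algebraMap ℂ (Plus A) (scalarPart B x) + toPlus a, ?_⟩
  have h1 : plusMap φ (algebraMap ℂ (Plus A) (scalarPart B x)) =
      algebraMap ℂ (Plus B) (scalarPart B x) := (plusAlgHom φ).commutes _
  rw [map_add, h1, plusMap_toPlus]
  nth_rewrite 1 [plus_eq x]
  rw [dist_add_left, dist_eq_norm, ← toPlus_sub, norm_toPlus, ← dist_eq_norm]
  exact ha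

theorem isUnit_one_add_of_norm_pow_le {R : Type*} [NormedRing R] [CompleteSpace R] {x : R}
    {C r : ℝ} (hr0 : 0 ≤ r) (hr : r < 1) (h : ∀ n : ℕ, ‖x ^ (n + 2)‖ ≤ C * r ^ n) :
    IsUnit (1 + x) := by
  have h1 : Tendsto (fun n : ℕ => C * r ^ n) atTop (𝓝 0) := by
    simpa using (tendsto_pow_atTop_nhds_zero_of_lt_one hr0 hr).const_mul C
  obtain ⟨n, hn⟩ := (h1.eventually_lt_const one_pos).exists
  have h2 : IsUnit (1 - (-x) ^ (n + 2)) := by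
    refine isUnit_one_sub_of_norm_lt_one ?_
    have : ‖(-x) ^ (n + 2)‖ = ‖x ^ (n + 2)‖ := by
      rcases Nat.even_or_odd (n + 2) with hn | hn
      · rw [hn.neg_pow]
      · rw [hn.neg_pow, norm_neg]
    rw [this]
    exact (h n).trans_lt hn
  have hc : Commute (1 - -x) (∑ i ∈ Finset.range (n + 2), (-x) ^ i) := by
    rw [Commute, SemiconjBy, mul_neg_geom_sum, geom_sum_mul_neg]
  rw [← mul_neg_geom_sum, hc.isUnit_mul_iff] at h2
  simpa using h2.1

variable [CompleteSpace A] {φ : A →ₙₐ[ℂ] B} {D : Set A}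

theorem isUnit_one_add_toPlus (hφ : ∀ a, ‖φ a‖ ≤ ‖a‖) (hD : Dense D)
    (h : ∀ a ∈ D, ∃ C, ∀ x, ‖a * x * a‖ ≤ C * ‖φ x‖) {a : A} (ha : ‖φ a‖ ≤ 1 / 2) :
    IsUnit (1 + toPlus a) := by
  obtain ⟨d, hd, had⟩ := hD.exists_dist_lt a (show (0 : ℝ) < 1 / 8 by norm_num)
  rw [dist_eq_norm] at had
  obtain ⟨C, hC⟩ := h d hd
  have hnorm (x : Plus A) : ‖plusMap φ x‖ ≤ ‖x‖ := by
    rw [norm_plusMap, norm_plus]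
    exact add_le_add_right (hφ _) _
  have hC' (x : Plus A) : ‖toPlus d * x * toPlus d‖ ≤ max C ‖d * d‖ * ‖plusMap φ x‖ := by
    have h1 : toPlus d * x * toPlus d =
        scalarPart A x • toPlus (d * d) + toPlus (d * (WithLp.ofLp x).snd * d) := by
      nth_rewrite 1 [plus_eq x]
      rw [mul_add, add_mul, toPlus_mul, toPlus_mul, toPlus_mul, ← Algebra.commutes, mul_assoc,
        ← Algebra.smul_def]
    rw [h1, norm_plusMap, mul_add]
    refine (norm_add_le _ _).trans (add_le_add ?_ ?_)
    · rw [norm_smul, norm_toPlus, mul_comm]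
      exact mul_le_mul_of_nonneg_right (le_max_right _ _) (norm_nonneg _)
    · rw [norm_toPlus]
      exact (hC _).trans (mul_le_mul_of_nonneg_right (le_max_left _ _) (norm_nonneg _))
  have hδ : ‖-toPlus (a - d)‖ < 1 := by
    rw [norm_neg, norm_toPlus]
    linarith
  obtain ⟨u, hu⟩ := isUnit_one_sub_of_norm_lt_one hδ
  have hu' : (↑u⁻¹ : Plus A) = 1 - ↑u⁻¹ * toPlus (a - d) := by
    have h1 := u.inv_mul
    rw [hu, sub_neg_eq_add, mul_add, mul_one] at h1
    exact eq_sub_of_add_eq h1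
  have h1norm : ‖(1 : Plus A)‖ = 1 := by
    rw [norm_plus, map_one, norm_one]
    show (1 : ℝ) + ‖(0 : A)‖ = 1
    simp
  have hv : ‖(↑u⁻¹ : Plus A)‖ ≤ 8 / 7 := by
    have h2 : ‖(↑u⁻¹ : Plus A)‖ ≤ 1 + ‖(↑u⁻¹ : Plus A)‖ * (1 / 8) := by
      nth_rewrite 1 [hu']
      refine (norm_sub_le _ _).trans ?_
      rw [h1norm]
      gcongr
      refine (norm_mul_le _ _).trans ?_
      rw [norm_toPlus]
      gcongr
    linarith
  obtain ⟨v, hvdef⟩ : ∃ v : Plus A, v = ↑u⁻¹ := ⟨_, rfl⟩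
  rw [← hvdef] at hv
  have hφd : ‖φ d‖ ≤ 5 / 8 := by
    have h3 : φ d = φ a - φ (a - d) := by rw [map_sub, sub_sub_cancel]
    rw [h3]
    refine (norm_sub_le _ _).trans ?_
    have := hφ (a - d)
    linarith
  set x := v * toPlus d with hx
  have hφx : ‖plusMap φ x‖ ≤ 5 / 7 := by
    rw [hx, map_mul, plusMap_toPlus]
    refine (norm_mul_le _ _).trans ?_
    rw [norm_toPlus]
    calc ‖plusMap φ v‖ * ‖φ d‖ ≤ (8 / 7) * (5 / 8) := by
          gcongr
          exact (hnorm v).trans hv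
      _ = 5 / 7 := by norm_num
  have hM : 0 ≤ max C ‖d * d‖ := (norm_nonneg _).trans (le_max_right _ _)
  have hone : 1 + toPlus a = u * (1 + x) := by
    rw [mul_add, mul_one, hx, hvdef, Units.mul_inv_cancel_left, hu, sub_neg_eq_add, toPlus_sub]
    abel
  rw [hone]
  refine u.isUnit.mul (isUnit_one_add_of_norm_pow_le (C := 8 / 7 * (max C ‖d * d‖ * (8 / 7)))
    (r := 5 / 7) (by norm_num) (by norm_num) fun n => ?_)
  have hpow : x ^ (n + 2) = v * (toPlus d * (x ^ n * v) * toPlus d) := by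
    rw [pow_succ, pow_succ', hx]
    simp only [mul_assoc]
  have hpn : ‖plusMap φ (x ^ n * v)‖ ≤ (5 / 7) ^ n * (8 / 7) := by
    clear hpow
    induction n with
    | zero => simpa using (hnorm v).trans hv
    | succ n ih =>
      rw [pow_succ', mul_assoc, map_mul, pow_succ', mul_assoc]
      exact (norm_mul_le _ _).trans (mul_le_mul hφx ih (norm_nonneg _) (by norm_num))
  calc ‖x ^ (n + 2)‖ ≤ ‖v‖ * ‖toPlus d * (x ^ n * v) * toPlus d‖ := by
        rw [hpow]; exact norm_mul_le _ _
    _ ≤ 8 / 7 * (max C ‖d * d‖ * ((5 / 7) ^ n * (8 / 7))) := by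
        gcongr
        exact (hC' _).trans (mul_le_mul_of_nonneg_left hpn hM)
    _ = _ := by ring

theorem denseSpectral_plusMap (hφ : ∀ a, ‖φ a‖ ≤ ‖a‖) (hr : DenseRange φ) (hD : Dense D)
    (h : ∀ a ∈ D, ∃ C, ∀ x, ‖a * x * a‖ ≤ C * ‖φ x‖) : DenseSpectral (plusMap φ) where
  continuous := continuous_plusMap φ
    (AddMonoidHomClass.continuous_of_bound φ 1 fun x => by rw [one_mul]; exact hφ x)
  denseRange := denseRange_plusMap hr
  isUnit_of_near_one := by
    refine ⟨Metric.ball 1 (1 / 4), Metric.ball_mem_nhds _ (by norm_num), fun x hx => ?_⟩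
    rw [mem_ball_iff_norm, ← map_one (plusMap φ), ← map_sub, norm_plusMap, map_sub, map_one] at hx
    have hsnd : (WithLp.ofLp (x - 1)).snd = (WithLp.ofLp x).snd :=
      sub_zero (WithLp.ofLp x).snd
    rw [hsnd] at hx
    obtain ⟨z, hz⟩ : ∃ z, z = scalarPart A x := ⟨_, rfl⟩
    obtain ⟨a, ha⟩ : ∃ a, a = (WithLp.ofLp x).snd := ⟨_, rfl⟩
    rw [← hz, ← ha] at hx
    have hz1 : 3 / 4 ≤ ‖z‖ := by
      have h1 : ‖(1 : ℂ)‖ ≤ ‖z‖ + ‖z - 1‖ := by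
        simpa using norm_sub_le z (z - 1)
      rw [norm_one] at h1
      linarith [norm_nonneg (φ a)]
    have hz0 : z ≠ 0 := by rintro rfl; norm_num at hz1
    have hxz : x = algebraMap ℂ (Plus A) z * (1 + toPlus (z⁻¹ • a)) := by
      rw [mul_add, mul_one, ← Algebra.smul_def, toPlus_smul, smul_smul, mul_inv_cancel₀ hz0,
        one_smul, hz, ha]
      exact plus_eq x
    rw [hxz]
    refine ((IsUnit.mk0 z hz0).map _).mul (isUnit_one_add_toPlus hφ hD h ?_)
    rw [map_smul, norm_smul, norm_inv]
    calc ‖z‖⁻¹ * ‖φ a‖ ≤ (3 / 4)⁻¹ * (1 / 4) := by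
          gcongr
          linarith [norm_nonneg (z - 1)]
      _ ≤ 1 / 2 := by norm_num

end Criterion

end BanachK

namespace BanachField

namespace EquivariantField

/-! ### The map `ι̂` -/

section Iota

variable {G Y : Type*} [Group G] [TopologicalSpace G] [IsTopologicalGroup G]
  [LocallyCompactSpace G] [T2Space G] [MeasurableSpace G] [BorelSpace G] {μ : Measure G}
  [μ.IsHaarMeasure] [TopologicalSpace Y] [MulAction G Y] [ContinuousSMul G Y]
  {B : Y → Type*} [∀ y, NonUnitalNormedRing (B y)] [∀ y, NormedSpace ℂ (B y)]
  [∀ y, IsScalarTower ℂ (B y) (B y)] [∀ y, SMulCommClass ℂ (B y) (B y)]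
  [∀ y, CompleteSpace (B y)] {E : EquivariantField G B}

theorem iota_apply (ξ : E.ConvAlg μ) (g : G) (y : Y) : ((E.iota μ ξ).1 g ()).1 y = ξ.1 g y := rfl

variable (E μ) in
/-- `ι̂` as a linear map. -/
noncomputable def iotaₗ : E.ConvAlg μ →ₗ[ℂ] E.pushforward.ConvAlg μ where
  toFun := E.iota μ
  map_add' _ _ := Subtype.ext (funext fun _ => funext fun _ => Subtype.ext (lp.ext rfl))
  map_smul' _ _ := Subtype.ext (funext fun _ => funext fun _ => Subtype.ext (lp.ext rfl))

variable (E) in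
/-- Evaluation of a section at a point. -/
noncomputable def evalL (y : Y) : E.Gamma0 →L[ℂ] B y :=
  LinearMap.mkContinuous
    { toFun := fun f => f.1 y, map_add' := fun _ _ => rfl, map_smul' := fun _ _ => rfl } 1
    fun f => by rw [one_mul]; exact USCField.Gamma0.norm_apply_le f y

theorem iota_mul (ξ η : E.ConvAlg μ) : E.iota μ (ξ * η) = E.iota μ ξ * E.iota μ η := by
  refine Subtype.ext (funext fun g => funext fun u => Subtype.ext (lp.ext (funext fun y => ?_)))
  exact (E.evalL y).integral_comp_comm
    (integrable_conv μ (E := E.pushforward) (E.iota μ ξ).2 (E.iota μ η).2 g u)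

theorem pushforward_norm_def (f : E.pushforward.ConvAlg μ) : ‖f‖ = ∫ g, ‖f.1 g ()‖ ∂μ := by
  rw [convAlg_norm_def]
  exact ciSup_unique

theorem norm_le_norm_iota (ξ : E.ConvAlg μ) : ‖ξ‖ ≤ ‖E.iota μ ξ‖ := by
  refine Real.iSup_le (fun y => ?_) (norm_nonneg _)
  rw [pushforward_norm_def]
  exact integral_mono (integrable_left μ ξ.2 y).norm
    (integrable_left μ (E := E.pushforward) (E.iota μ ξ).2 ()).norm
    fun g => USCField.Gamma0.norm_apply_le ((E.iota μ ξ).1 g ()) y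

theorem pushforward_norm_le {f : E.pushforward.ConvAlg μ} {C : ℝ} {M : Set G} (hM : IsCompact M)
    (h0 : ∀ g ∉ M, f.1 g () = 0) (hC : ∀ g, ‖f.1 g ()‖ ≤ C) : ‖f‖ ≤ C * μ.real M := by
  rw [pushforward_norm_def, ← setIntegral_eq_integral_of_forall_compl_eq_zero (s := M)
    fun g hg => by rw [h0 g hg, norm_zero]]
  refine (le_abs_self _).trans ?_
  rw [← Real.norm_eq_abs]
  exact norm_setIntegral_le_of_norm_le_const hM.measure_lt_top fun g _ => by
    rw [norm_norm]; exact hC g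

theorem exists_norm_le (ξ : E.ConvAlg μ) : ∃ C, 0 ≤ C ∧ ∀ g y, ‖ξ.1 g y‖ ≤ C := by
  obtain ⟨h, K, hK, h1⟩ := id ξ.2
  obtain ⟨C, h0, hC⟩ := h.exists_bound continuous_snd hK
  refine ⟨C, h0, fun g y => ?_⟩
  by_cases hg : (g, y) ∈ K
  · exact hC _ hg
  · simpa [h1 g y hg] using h0

theorem norm_mul_apply_le (ξ η : E.ConvAlg μ) {C : ℝ} (hC0 : 0 ≤ C)
    (hC : ∀ g y, ‖η.1 g y‖ ≤ C) (g : G) (y : Y) : ‖(ξ * η).1 g y‖ ≤ ‖ξ‖ * C := by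
  calc ‖(ξ * η).1 g y‖ ≤ ∫ h, ‖ξ.1 h y‖ * C ∂μ := by
        refine norm_integral_le_of_norm_le ((integrable_left μ ξ.2 y).norm.mul_const C)
          (Eventually.of_forall fun h => (norm_mul_le _ _).trans ?_)
        rw [E.norm_act]
        exact mul_le_mul_of_nonneg_left (hC _ _) (norm_nonneg _)
    _ = (∫ h, ‖ξ.1 h y‖ ∂μ) * C := integral_mul_const _ _
    _ ≤ ‖ξ‖ * C := mul_le_mul_of_nonneg_right (integral_le_l1norm μ ξ.2 y) hC0

theorem mul_apply_eq_zero_of_range {ξ : E.ConvAlg μ} {L : Set Y}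
    (h : ∀ g, ∀ y ∉ L, ξ.1 g y = 0) (η : E.ConvAlg μ) (g : G) {y : Y} (hy : y ∉ L) :
    (ξ * η).1 g y = 0 :=
  integral_eq_zero_of_ae (Eventually.of_forall fun k => by simp [h k y hy])

theorem mul_apply_eq_zero_of_source {η : E.ConvAlg μ} {L : Set Y}
    (h : ∀ g y, g⁻¹ • y ∉ L → η.1 g y = 0) (ξ : E.ConvAlg μ) (g : G) (y : Y)
    (hy : g⁻¹ • y ∉ L) : (ξ * η).1 g y = 0 :=
  integral_eq_zero_of_ae (Eventually.of_forall fun k => by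
    have h1 : η.1 (k⁻¹ * g) (k⁻¹ • y) = 0 := h _ _ (by simpa [← mul_smul] using hy)
    simp [h1])

theorem exists_compact_range (ξ : E.ConvAlg μ) :
    ∃ L : Set Y, IsCompact L ∧ ∀ g, ∀ y ∉ L, ξ.1 g y = 0 := by
  obtain ⟨-, K, hK, h1⟩ := ξ.2
  exact ⟨Prod.snd '' K, hK.image continuous_snd, fun g y hy => h1 g y fun h => hy ⟨_, h, rfl⟩⟩

theorem exists_compact_source (ξ : E.ConvAlg μ) :
    ∃ L : Set Y, IsCompact L ∧ ∀ g y, g⁻¹ • y ∉ L → ξ.1 g y = 0 := by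
  obtain ⟨-, K, hK, h1⟩ := ξ.2
  exact ⟨(fun q : G × Y => q.1⁻¹ • q.2) '' K, hK.image (by fun_prop),
    fun g y hy => h1 g y fun h => hy ⟨_, h, rfl⟩⟩

theorem exists_norm_iota_mul_le_of_proper [ProperSMul G Y] (ξ : E.ConvAlg μ) :
    ∃ C, ∀ x : E.ConvAlg μ, ‖E.iota μ (ξ * (x * ξ))‖ ≤ C * ‖x‖ := by
  obtain ⟨L, hL, h1⟩ := exists_compact_range ξ
  obtain ⟨L', hL', h2⟩ := exists_compact_source ξ
  obtain ⟨C, hC0, hC⟩ := exists_norm_le ξ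
  have hP : IsCompact ((fun q : G × Y => (q.1 • q.2, q.2)) ⁻¹' (L ×ˢ L')) :=
    ProperSMul.isProperMap_smul_pair.isCompact_preimage (hL.prod hL')
  have hM : IsCompact (Prod.fst '' ((fun q : G × Y => (q.1 • q.2, q.2)) ⁻¹' (L ×ˢ L'))) :=
    hP.image continuous_fst
  set M := Prod.fst '' ((fun q : G × Y => (q.1 • q.2, q.2)) ⁻¹' (L ×ˢ L')) with hMdef
  refine ⟨‖ξ‖ * C * μ.real M, fun x => ?_⟩
  have h3 : ‖E.iota μ (ξ * (x * ξ))‖ ≤ (‖ξ‖ * (‖x‖ * C)) * μ.real M := by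
    have h4 : 0 ≤ ‖x‖ * C := mul_nonneg (norm_nonneg _) hC0
    refine pushforward_norm_le hM (fun g hg => ?_) fun g => ?_
    · refine Subtype.ext (lp.ext (funext fun y => ?_))
      rw [iota_apply]
      by_cases hy : y ∈ L
      · refine mul_apply_eq_zero_of_source (L := L') (mul_apply_eq_zero_of_source h2 x) ξ g y
          fun hy' => hg ⟨(g, g⁻¹ • y), ⟨?_, hy'⟩, rfl⟩
        simpa using hy
      · exact mul_apply_eq_zero_of_range h1 _ g hy
    · exact USCField.Gamma0.norm_le (mul_nonneg (norm_nonneg _) h4) fun y =>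
        norm_mul_apply_le ξ (x * ξ) h4 (norm_mul_apply_le x ξ hC0 hC) g y
  exact h3.trans_eq (by ring)

theorem exists_norm_iota_mul_le_of_discrete [DiscreteTopology Y] (ξ : E.ConvAlg μ) :
    ∃ C, ∀ x : E.ConvAlg μ, ‖E.iota μ (ξ * (x * ξ))‖ ≤ C * ‖x‖ := by
  obtain ⟨L, hL, h1⟩ := exists_compact_range ξ
  obtain ⟨s, rfl⟩ := hL.finite_of_discrete.exists_finset_coe
  have key (ζ : E.ConvAlg μ) (hζ : ∀ g, ∀ y ∉ s, ζ.1 g y = 0) : ‖E.iota μ ζ‖ ≤ s.card * ‖ζ‖ := by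
    rw [pushforward_norm_def]
    calc ∫ g, ‖(E.iota μ ζ).1 g ()‖ ∂μ ≤ ∫ g, ∑ y ∈ s, ‖ζ.1 g y‖ ∂μ := by
          refine integral_mono (integrable_left μ (E := E.pushforward) (E.iota μ ζ).2 ()).norm
            (integrable_finsetSum s fun y _ => (integrable_left μ ζ.2 y).norm) fun g => ?_
          refine USCField.Gamma0.norm_le (Finset.sum_nonneg fun _ _ => norm_nonneg _) fun y => ?_
          rw [iota_apply]
          by_cases hy : y ∈ s
          · exact Finset.single_le_sum (f := fun y => ‖ζ.1 g y‖) (fun _ _ => norm_nonneg _) hy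
          · rw [hζ g y hy, norm_zero]
            exact Finset.sum_nonneg fun _ _ => norm_nonneg _
      _ = ∑ y ∈ s, ∫ g, ‖ζ.1 g y‖ ∂μ :=
          integral_finsetSum s fun y _ => (integrable_left μ ζ.2 y).norm
      _ ≤ s.card • ‖ζ‖ := Finset.sum_le_card_nsmul s _ _ fun y _ => integral_le_l1norm μ ζ.2 y
      _ = s.card * ‖ζ‖ := nsmul_eq_mul _ _
  refine ⟨s.card * (‖ξ‖ * ‖ξ‖), fun x => ?_⟩
  calc ‖E.iota μ (ξ * (x * ξ))‖ ≤ s.card * ‖ξ * (x * ξ)‖ :=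
        key _ fun g y hy => mul_apply_eq_zero_of_range h1 _ g (by simpa using hy)
    _ ≤ s.card * (‖ξ‖ * (‖x‖ * ‖ξ‖)) := by
        gcongr
        exact (norm_mul_le _ _).trans (mul_le_mul_of_nonneg_left (norm_mul_le _ _) (norm_nonneg _))
    _ = _ := by ring

end Iota

/-! ### Density of the image of `ι̂` -/

section Density

variable {G Y : Type*} [Group G] [TopologicalSpace G] [IsTopologicalGroup G]
  [LocallyCompactSpace G] [T2Space G] [MeasurableSpace G] [BorelSpace G] {μ : Measure G}
  [μ.IsHaarMeasure] [TopologicalSpace Y] [LocallyCompactSpace Y] [T2Space Y] [MulAction G Y]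
  [ContinuousSMul G Y]
  {B : Y → Type*} [∀ y, NonUnitalNormedRing (B y)] [∀ y, NormedSpace ℂ (B y)]
  [∀ y, IsScalarTower ℂ (B y) (B y)] [∀ y, SMulCommClass ℂ (B y) (B y)]
  [∀ y, CompleteSpace (B y)] {E : EquivariantField G B}

/-- Cutting off a compactly supported function `G → Γ₀(Y, B)` by a compactly supported function
on `Y`. -/
noncomputable def cutoff (f : E.pushforward.ConvAlg μ) (χ : C(Y, ℝ)) (hχ : HasCompactSupport χ) :
    E.ConvAlg μ :=
  ⟨fun g y => (χ y : ℂ) • (f.1 g ()).1 y, by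
    constructor
    · rintro ⟨g₀, y₀⟩ ε hε
      refine ⟨fun y => (χ y₀ : ℂ) • (f.1 g₀ ()).1 y,
        E.sections.smul_mem _ (f.1 g₀ ()).2.1, ?_⟩
      have h1 : Tendsto (fun q : G × Y => |χ q.2| * ‖f.1 q.1 () - f.1 g₀ ()‖ +
          |χ q.2 - χ y₀| * ‖f.1 g₀ ()‖) (𝓝 (g₀, y₀)) (𝓝 0) := by
        have hf := continuous_left (E := E.pushforward) f.2 ()
        have : Continuous fun q : G × Y => |χ q.2| * ‖f.1 q.1 () - f.1 g₀ ()‖ +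
          |χ q.2 - χ y₀| * ‖f.1 g₀ ()‖ := by fun_prop
        simpa using this.tendsto (g₀, y₀)
      filter_upwards [h1.eventually_le_const hε] with q hq
      refine le_trans ?_ hq
      have h2 : (χ q.2 : ℂ) • (f.1 q.1 ()).1 q.2 - (χ y₀ : ℂ) • (f.1 g₀ ()).1 q.2 =
          (χ q.2 : ℂ) • (f.1 q.1 () - f.1 g₀ ()).1 q.2 +
          ((χ q.2 - χ y₀ : ℝ) : ℂ) • (f.1 g₀ ()).1 q.2 := by
        have h3 : (f.1 q.1 () - f.1 g₀ ()).1 q.2 = (f.1 q.1 ()).1 q.2 - (f.1 g₀ ()).1 q.2 := rfl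
        rw [h3, smul_sub, Complex.ofReal_sub, sub_smul]
        abel
      show ‖(χ q.2 : ℂ) • (f.1 q.1 ()).1 q.2 - (χ y₀ : ℂ) • (f.1 g₀ ()).1 q.2‖ ≤ _
      rw [h2]
      refine (norm_add_le _ _).trans (add_le_add ?_ ?_) <;>
      rw [norm_smul, Complex.norm_real, Real.norm_eq_abs] <;>
      exact mul_le_mul_of_nonneg_left (USCField.Gamma0.norm_apply_le _ _) (abs_nonneg _)
    · obtain ⟨M, hM, h1⟩ := exists_compact_left (E := E.pushforward) f.2
      refine ⟨M ×ˢ tsupport χ, hM.prod hχ, fun g y hg => ?_⟩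
      by_cases hgM : g ∈ M
      · have h2 : χ y = 0 := image_eq_zero_of_notMem_tsupport fun hy => hg ⟨hgM, hy⟩
        show (χ y : ℂ) • (f.1 g ()).1 y = 0
        rw [h2, Complex.ofReal_zero, zero_smul]
      · have h2 : (f.1 g ()).1 y = 0 := by rw [h1 g () hgM]; rfl
        show (χ y : ℂ) • (f.1 g ()).1 y = 0
        rw [h2, smul_zero]⟩

theorem denseRange_iota : DenseRange (E.iota μ) := by
  refine Metric.denseRange_iff.2 fun f r hr => ?_
  obtain ⟨M, hM, h1⟩ := exists_compact_left (E := E.pushforward) f.2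
  obtain ⟨ε, hε, hεr⟩ : ∃ ε > 0, ε * μ.real M < r := by
    refine ⟨r / (μ.real M + 1), by positivity, ?_⟩
    rw [div_mul_eq_mul_div, div_lt_iff₀ (by positivity)]
    exact mul_lt_mul_of_pos_left (lt_add_one _) hr
  have hf := continuous_left (E := E.pushforward) f.2 ()
  obtain ⟨K, hK, h2⟩ : ∃ K : Set Y, IsCompact K ∧ ∀ g ∈ M, ∀ y ∉ K, ‖(f.1 g ()).1 y‖ ≤ ε := by
    refine hM.induction_on (p := fun s => ∃ K : Set Y, IsCompact K ∧ ∀ g ∈ s, ∀ y ∉ K,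
      ‖(f.1 g ()).1 y‖ ≤ ε) ⟨∅, isCompact_empty, by simp⟩ ?_ ?_ fun g₀ _ => ?_
    · rintro s t hst ⟨K, hK, h⟩
      exact ⟨K, hK, fun g hg => h g (hst hg)⟩
    · rintro s t ⟨K, hK, h⟩ ⟨K', hK', h'⟩
      refine ⟨K ∪ K', hK.union hK', ?_⟩
      rintro g (hg | hg) y hy
      · exact h g hg y fun h => hy (Or.inl h)
      · exact h' g hg y fun h => hy (Or.inr h)
    · obtain ⟨K, hK, h⟩ := (f.1 g₀ ()).2.2 (ε / 2) (half_pos hε)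
      refine ⟨_, mem_nhdsWithin_of_mem_nhds (hf.continuousAt
        (Metric.ball_mem_nhds (f.1 g₀ ()) (half_pos hε))), K, hK, fun g hg y hy => ?_⟩
      have h3 : ‖f.1 g () - f.1 g₀ ()‖ < ε / 2 := mem_ball_iff_norm.1 hg
      have h4 : ‖(f.1 g ()).1 y - (f.1 g₀ ()).1 y‖ ≤ ‖f.1 g () - f.1 g₀ ()‖ :=
        USCField.Gamma0.norm_apply_le (f.1 g () - f.1 g₀ ()) y
      have h5 := norm_le_norm_add_norm_sub' ((f.1 g ()).1 y) ((f.1 g₀ ()).1 y)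
      have h6 := h y hy
      linarith
  obtain ⟨χ, hχ1, -, hχc, hχ⟩ := exists_continuous_one_zero_of_isCompact hK isClosed_empty
    (disjoint_empty K)
  refine ⟨cutoff f χ hχc, ?_⟩
  rw [dist_eq_norm]
  refine lt_of_le_of_lt (pushforward_norm_le (C := ε) hM (fun g hg => ?_) fun g => ?_) hεr
  · refine Subtype.ext (lp.ext (funext fun y => ?_))
    have h2 : (f.1 g ()).1 y = 0 := by rw [h1 g () hg]; rfl
    show (f.1 g ()).1 y - (χ y : ℂ) • (f.1 g ()).1 y = 0
    rw [h2, smul_zero, sub_zero]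
  · refine USCField.Gamma0.norm_le hε.le fun y => ?_
    show ‖(f.1 g ()).1 y - (χ y : ℂ) • (f.1 g ()).1 y‖ ≤ ε
    by_cases hg : g ∈ M
    · by_cases hy : y ∈ K
      · have h3 : χ y = 1 := hχ1 hy
        rw [h3, Complex.ofReal_one, one_smul, sub_self, norm_zero]
        exact hε.le
      · have h3 : (f.1 g ()).1 y - (χ y : ℂ) • (f.1 g ()).1 y =
            ((1 - χ y : ℝ) : ℂ) • (f.1 g ()).1 y := by
          rw [Complex.ofReal_sub, sub_smul, Complex.ofReal_one, one_smul]
        rw [h3, norm_smul, Complex.norm_real, Real.norm_of_nonneg (by linarith [(hχ y).2])]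
        exact (mul_le_of_le_one_left (norm_nonneg _) (by linarith [(hχ y).1])).trans (h2 g hg y hy)
    · have h3 : (f.1 g ()).1 y = 0 := by rw [h1 g () hg]; rfl
      rw [h3, smul_zero, sub_zero, norm_zero]
      exact hε.le

variable (E μ) in
/-- `ι̂` as a linear map into the completion. -/
noncomputable def iotaL1 : E.ConvAlg μ →ₗ[ℂ] E.pushforward.L1 μ :=
  (UniformSpace.Completion.toComplₗᵢ (𝕜 := ℂ) (E := E.pushforward.ConvAlg μ)).toLinearMap ∘ₗ
    E.iotaₗ μ

theorem iotaL1_apply (ξ : E.ConvAlg μ) : E.iotaL1 μ ξ = (E.iota μ ξ : E.pushforward.L1 μ) := rfl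

theorem iotaL1_mul (ξ η : E.ConvAlg μ) :
    E.iotaL1 μ (ξ * η) = E.iotaL1 μ ξ * E.iotaL1 μ η := by
  rw [iotaL1_apply, iota_mul]
  exact compl_coe_mul _ _ _

theorem denseRange_iotaL1 : DenseRange (E.iotaL1 μ) :=
  UniformSpace.Completion.denseRange_coe.comp denseRange_iota
    (UniformSpace.Completion.continuous_coe _)

theorem norm_iotaL1 (ξ : E.ConvAlg μ) : ‖E.iotaL1 μ ξ‖ = ‖E.iota μ ξ‖ :=
  UniformSpace.Completion.norm_coe _

variable (E μ) in
/-- The continuous linear extension of `ι̂(ξ) ↦ ξ`. -/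
noncomputable def psiL : E.pushforward.L1 μ →L[ℂ] E.L1 μ :=
  (UniformSpace.Completion.toComplₗᵢ (𝕜 := ℂ) (E := E.ConvAlg μ)).toLinearMap.extendOfNorm
    (E.iotaL1 μ)

theorem norm_coe_le_norm_iotaL1 (ξ : E.ConvAlg μ) : ‖(UniformSpace.Completion.toComplₗᵢ (𝕜 := ℂ)
    (E := E.ConvAlg μ)).toLinearMap ξ‖ ≤ 1 * ‖E.iotaL1 μ ξ‖ := by
  rw [norm_iotaL1, one_mul]
  exact (UniformSpace.Completion.norm_coe ξ).trans_le (norm_le_norm_iota ξ)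

theorem psiL_iota (ξ : E.ConvAlg μ) : E.psiL μ (E.iotaL1 μ ξ) = (ξ : E.L1 μ) :=
  LinearMap.extendOfNorm_eq denseRange_iotaL1 ⟨1, norm_coe_le_norm_iotaL1⟩ ξ

theorem norm_psiL_le (x : E.pushforward.L1 μ) : ‖E.psiL μ x‖ ≤ ‖x‖ := by
  have := LinearMap.norm_extendOfNorm_apply_le denseRange_iotaL1 1
    (norm_coe_le_norm_iotaL1 (E := E) (μ := μ)) x
  rwa [one_mul] at this

theorem psiL_mul (x y : E.pushforward.L1 μ) : E.psiL μ (x * y) = E.psiL μ x * E.psiL μ y := by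
  refine denseRange_iotaL1.induction_on₂ (isClosed_eq ?_ ?_) (fun ξ η => ?_) x y
  · exact (E.psiL μ).continuous.comp continuous_mul
  · exact ((E.psiL μ).continuous.comp continuous_fst).mul
      ((E.psiL μ).continuous.comp continuous_snd)
  · rw [← iotaL1_mul, psiL_iota, psiL_iota, psiL_iota]
    exact compl_coe_mul _ _ _

variable (E μ) in
/-- The homomorphism `ψ_B : L¹(G, Γ₀(Y, B)) → L¹(G ⋉ Y, B)`. -/
noncomputable def psi : E.pushforward.L1 μ →ₙₐ[ℂ] E.L1 μ where
  toFun := E.psiL μ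
  map_smul' := map_smul (E.psiL μ)
  map_zero' := map_zero (E.psiL μ)
  map_add' := map_add (E.psiL μ)
  map_mul' := psiL_mul

theorem denseRange_psi : DenseRange (E.psi μ) :=
  DenseRange.of_comp (f := E.psi μ) (g := E.iotaL1 μ) (by
    have : E.psi μ ∘ E.iotaL1 μ = ((↑) : E.ConvAlg μ → E.L1 μ) := funext psiL_iota
    rw [this]
    exact UniformSpace.Completion.denseRange_coe)

theorem denseSpectral_plusMap_psi (hY : ProperSMul G Y ∨ DiscreteTopology Y) :
    BanachK.DenseSpectral (BanachK.plusMap (E.psi μ)) := by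
  refine BanachK.denseSpectral_plusMap norm_psiL_le denseRange_psi (D := range (E.iotaL1 μ))
    denseRange_iotaL1 ?_
  rintro _ ⟨ξ, rfl⟩
  obtain ⟨C, hC⟩ : ∃ C, ∀ x : E.ConvAlg μ, ‖E.iota μ (ξ * (x * ξ))‖ ≤ C * ‖x‖ := by
    rcases hY with h | h
    · exact exists_norm_iota_mul_le_of_proper ξ
    · exact exists_norm_iota_mul_le_of_discrete ξ
  refine ⟨C, fun x => denseRange_iotaL1.induction_on x (isClosed_le ?_ ?_) fun η => ?_⟩
  · fun_prop
  · exact ((E.psiL μ).continuous.norm).const_mul C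
  · show _ ≤ C * ‖E.psiL μ (E.iotaL1 μ η)‖
    rw [← iotaL1_mul, ← iotaL1_mul, norm_iotaL1, mul_assoc, psiL_iota,
      UniformSpace.Completion.norm_coe]
    exact hC η

end Density

end EquivariantField

end BanachField

theorem mainTheorem11
    {G Y : Type*} [Group G] [TopologicalSpace G] [IsTopologicalGroup G] [LocallyCompactSpace G]
    [T2Space G] [MeasurableSpace G] [BorelSpace G] (μ : Measure G) [μ.IsHaarMeasure]
    [TopologicalSpace Y] [LocallyCompactSpace Y] [T2Space Y] [MulAction G Y] [ContinuousSMul G Y]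
    {B : Y → Type*} [∀ y, NonUnitalNormedRing (B y)] [∀ y, NormedSpace ℂ (B y)]
    [∀ y, IsScalarTower ℂ (B y) (B y)] [∀ y, SMulCommClass ℂ (B y) (B y)]
    [∀ y, CompleteSpace (B y)]
    (E : BanachField.EquivariantField G B) (hY : ProperSMul G Y ∨ DiscreteTopology Y) :
    ∃ (ψ : E.pushforward.L1 μ →ₙₐ[ℂ] E.L1 μ) (hψ : Continuous ψ),
      (∀ ξ : E.ConvAlg μ, ψ (E.iota μ ξ : E.pushforward.L1 μ) = (ξ : E.L1 μ)) ∧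
      (∀ ψ' : E.pushforward.L1 μ →ₙₐ[ℂ] E.L1 μ, Continuous ψ' →
        (∀ ξ : E.ConvAlg μ, ψ' (E.iota μ ξ : E.pushforward.L1 μ) = (ξ : E.L1 μ)) → ψ' = ψ) ∧
      (∀ x, ‖ψ x‖ ≤ ‖x‖) ∧
      Function.Bijective (BanachK.K0.map ψ) ∧
      Function.Bijective (BanachK.K1.map ψ hψ) := by
  have hs := BanachField.EquivariantField.denseSpectral_plusMap_psi (E := E) (μ := μ) hY
  refine ⟨E.psi μ, (E.psiL μ).continuous, BanachField.EquivariantField.psiL_iota,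
    fun ψ' hψ' h => DFunLike.coe_injective ?_, BanachField.EquivariantField.norm_psiL_le,
    BanachK.K0.bijective_map _ hs, BanachK.K1.bijective_map _ _ hs⟩
  refine BanachField.EquivariantField.denseRange_iotaL1.equalizer hψ' (E.psiL μ).continuous
    (funext fun ξ => ?_)
  exact (h ξ).trans (BanachField.EquivariantField.psiL_iota ξ).symm
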